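/- Let $\mathcal H$ be a finite-dimensional complex Hilbert space with a fixed orthonormal basis containing a vector $|0\rangle$, and let $\rho\in\mathcal S(\mathcal H)$ be a density operator (positive semidefinite, trace one). *Smooth adiabatic operations.* For density operators $\rho,\sigma$ on the same space write $\rho\prec_{\mathrm M}\sigma$ if for every $k$ the sum of the $k$ largest eigenvalues of $\rho$ is at least that of $\sigma$. Write $\rho\prec_{\mathrm M}^{\epsilon}\sigma$ if there are density operators $\rho',\sigma'$ and numbers $\epsilon',\epsilon''$ with $\rho'\prec_{\mathrm M}\sigma'$, $\tfrac12\|\rho-\rho'\|_1\le\epsilon'$, $\tfrac12\|\sigma-\sigma'\|_1\le\epsilon''$ and $\epsilon'+\epsilon''\le\epsilon$. *Meter.* For integers $s>1$ and $1\le m\le s$, the meter state $\chi_\lambda$ with $\lambda=\log_2 m$ on a meter of dimension $s$ is diagonal with eigenvalue $2^{-\lambda}=1/m$ of multiplicity $m$ and eigenvalue $0$ of multiplicity $s-m$. With a reference state $X_{\mathrm{ref}}$ on the same space as $X$, put $$S_-^{\epsilon}(X)=\sup\{\lambda_1-\lambda_2 : X_{\mathrm{ref}}\otimes\chi_{\lambda_1}\prec_{\mathrm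 M}^{\epsilon}X\otimes\chi_{\lambda_2}\},\qquad S_+^{\epsilon}(X)=\inf\{\lambda_2-\lambda_1 : X\otimes\chi_{\lambda_1}\prec_{\mathrm M}^{\epsilon}X_{\mathrm{ref}}\otimes\chi_{\lambda_2}\},$$ where the optimisation runs over meters of all dimensions $s>1$ and all pairs of their states. *Macroscopic states.* For real $n\ge 0$ let $\Gamma(n)=\mathcal S(\mathcal H^{\otimes\lceil n\rceil})$ with reference state $X_{\mathrm{ref}}(n)=(|0\rangle\langle 0|)^{\otimes\lceil n\rceil}$, and let $\Gamma_{\mathrm M}(n)$ be the set of the states $\tau_\lambda\in\Gamma(n)$ with $S_-^0(\tau_\lambda)=S_+^0(\tau_\lambda)=\lambda$. A macroscopic state is a function $X_\infty: n\mapsto X(n)\in\Gamma(n)$ on $\mathbb R_{\ge0}$; write $X_\infty\prec_\infty Y_\infty$ if for every $\epsilon>0$ there is $n_0$ with $X(n)\prec_{\mathrm M}^{\epsilon}Y(n)$ for all $n\ge n_0$. A macroscopic state $X_\infty$ is a *thermodynamic equilibrium state with parameter* $\lambda\in\mathbb R$ if for every $\delta>0$ there are macroscopic states $n\mapsto\tau_{\lambda_n^-}\in\Gamma_{\mathrm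 M}(n)$ and $n\mapsto\tau_{\lambda_n^+}\in\Gamma_{\mathrm M}(n)$ such that $$\tau_{\lambda_\infty^-}\prec_\infty X_\infty\prec_\infty\tau_{\lambda_\infty^+}$$ and, for all sufficiently large $n$, $\lambda_n^-\ge n(\lambda-\delta)$ and $\lambda_n^+\le n(\lambda+\delta)$. It is a thermodynamic equilibrium state if it is one with some parameter. **Proposition.** The i.i.d. macroscopic state $\rho_\infty:n\mapsto\rho^{\otimes\lceil n\rceil}$ is a thermodynamic equilibrium state. A real number $\lambda$ is a parameter of $\rho_\infty$ if and only if $\lambda$ is the von Neumann entropy $H(\rho)=-\operatorname{tr}(\rho\log_2\rho)$. -/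

import Mathlib

open scoped NNReal Matrix Kronecker ComplexOrder

namespace SmoothThermo

universe u v

/-- A density operator on the Hilbert space `ℂ^κ` with orthonormal basis indexed by `κ`. -/
structure DensityMatrix (κ : Type u) [Fintype κ] where
  toMatrix : Matrix κ κ ℂ
  posSemidef : toMatrix.PosSemidef
  trace_eq_one : toMatrix.trace = 1

namespace DensityMatrix

variable {κ : Type u} {μ : Type v} [Fintype κ] [Fintype μ]

theorem isHermitian (ρ : DensityMatrix κ) : ρ.toMatrix.IsHermitian :=
  ρ.posSemidef.isHermitian

/-- Composition of states: the tensor product `ρ ⊗ σ`. -/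
def tensor (ρ : DensityMatrix κ) (σ : DensityMatrix μ) : DensityMatrix (κ × μ) where
  toMatrix := ρ.toMatrix ⊗ₖ σ.toMatrix
  posSemidef := ρ.posSemidef.kronecker σ.posSemidef
  trace_eq_one := by
    rw [Matrix.trace_kronecker, ρ.trace_eq_one, σ.trace_eq_one, one_mul]

/-- The pure state `|o⟩⟨o|` of a basis vector. -/
def pureState [DecidableEq κ] (o : κ) : DensityMatrix κ where
  toMatrix := Matrix.diagonal fun i => if i = o then 1 else 0
  posSemidef := Matrix.PosSemidef.diagonal fun i => by
    dsimp only [Pi.zero_apply]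
    split_ifs <;> simp
  trace_eq_one := by simp [Matrix.trace_diagonal]

/-- The matrix of `A^{⊗N}` in the product basis of `(ℂ^κ)^{⊗N}`, indexed by `Fin N → κ`. -/
def matrixTensorPower (A : Matrix κ κ ℂ) (N : ℕ) : Matrix (Fin N → κ) (Fin N → κ) ℂ :=
  Matrix.of fun x y => ∏ i, A (x i) (y i)

theorem matrixTensorPower_conjTranspose_mul_self (B : Matrix κ κ ℂ) (N : ℕ) :
    matrixTensorPower (Bᴴ * B) N = (matrixTensorPower B N)ᴴ * matrixTensorPower B N := by
  ext x y
  simp only [matrixTensorPower, Matrix.of_apply, Matrix.mul_apply, Matrix.conjTranspose_apply,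
    star_prod, ← Finset.prod_mul_distrib]
  rw [Finset.prod_univ_sum, Fintype.piFinset_univ]

theorem trace_matrixTensorPower (A : Matrix κ κ ℂ) (N : ℕ) :
    (matrixTensorPower A N).trace = A.trace ^ N := by
  simp only [matrixTensorPower, Matrix.trace, Matrix.diag_apply, Matrix.of_apply]
  rw [Fintype.sum_pow]

variable [DecidableEq κ]

open scoped MatrixOrder in
/-- The state `ρ^{⊗N}` of `N` independent copies. -/
def tensorPower (ρ : DensityMatrix κ) (N : ℕ) : DensityMatrix (Fin N → κ) where
  toMatrix := matrixTensorPower ρ.toMatrix N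
  posSemidef := by
    obtain ⟨B, hB⟩ := CStarAlgebra.nonneg_iff_eq_star_mul_self.mp ρ.posSemidef.nonneg
    rw [hB, Matrix.star_eq_conjTranspose, matrixTensorPower_conjTranspose_mul_self]
    exact Matrix.posSemidef_conjTranspose_mul_self _
  trace_eq_one := by rw [trace_matrixTensorPower, ρ.trace_eq_one, one_pow]

/-- The sum of the `k` largest eigenvalues; `eigenvalues₀` lists the eigenvalues with
multiplicity in decreasing order. -/
noncomputable def topSum (ρ : DensityMatrix κ) (k : ℕ) : ℝ :=
  ∑ i : Fin (Fintype.card κ) with i.val < k, ρ.isHermitian.eigenvalues₀ i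

/-- `ρ ≺_M σ`: the state `ρ` majorises the state `σ`. -/
def Majorises (ρ σ : DensityMatrix κ) : Prop :=
  ∀ k : ℕ, 1 ≤ k → k ≤ Fintype.card κ → σ.topSum k ≤ ρ.topSum k

/-- The trace distance `½ ‖ρ - σ‖₁`; the trace norm of a Hermitian matrix is the sum of the
absolute values of its eigenvalues. -/
noncomputable def traceDist (ρ σ : DensityMatrix κ) : ℝ :=
  (1 / 2) * ∑ i, |(ρ.isHermitian.sub σ.isHermitian).eigenvalues i|

/-- The set of states that are `ε`-close to `ρ` in trace distance. -/
def epsBall (ε : ℝ) (ρ : DensityMatrix κ) : Set (DensityMatrix κ) :=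
  {ρ' | ρ.traceDist ρ' ≤ ε}

/-- `ρ ≺_M^ε σ`: the smooth adiabatic order relation with error tolerance `ε`. -/
def SmoothMajorises (ε : ℝ) (ρ σ : DensityMatrix κ) : Prop :=
  ∃ (ρ' σ' : DensityMatrix κ) (ε' ε'' : ℝ),
    ρ'.Majorises σ' ∧ ρ' ∈ epsBall ε' ρ ∧ σ' ∈ epsBall ε'' σ ∧ ε' + ε'' ≤ ε

/-- The von Neumann entropy `H(ρ) = - tr (ρ log₂ ρ)`, with `log₂ ρ` given by the functional
calculus (`Real.logb 2 0 = 0` implements the convention `0 log₂ 0 = 0`). -/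
noncomputable def vonNeumannEntropy (ρ : DensityMatrix κ) : ℝ :=
  -(ρ.toMatrix * cfc (Real.logb 2) ρ.toMatrix).trace.re

end DensityMatrix

/-- The meter state `χ_λ` with `λ = log₂ m` on a meter of dimension `s`, where `1 ≤ m ≤ s`:
its spectrum consists of `1 / m = 2^{-λ}` with multiplicity `m = 2^λ` and of `0` with
multiplicity `s - m`. -/
noncomputable def meterState (s : ℕ) (m : Finset.Icc 1 s) : DensityMatrix (Fin s) where
  toMatrix := Matrix.diagonal fun i => if i.val < m.val then (m.val : ℂ)⁻¹ else 0
  posSemidef := Matrix.PosSemidef.diagonal fun i => by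
    dsimp only [Pi.zero_apply]
    split_ifs
    · positivity
    · exact le_rfl
  trace_eq_one := by
    obtain ⟨m, hm⟩ := m
    obtain ⟨h1, h2⟩ := Finset.mem_Icc.mp hm
    have h0 : (m : ℂ) ≠ 0 := by exact_mod_cast (by omega : m ≠ 0)
    simp only [Matrix.trace_diagonal]
    rw [← Finset.sum_filter, Finset.sum_const, nsmul_eq_mul, Fin.card_filter_val_lt,
      min_eq_right h2, mul_inv_cancel₀ h0]

/-- The parameter `λ = log₂ m` of a meter state. -/
noncomputable def meterParam {s : ℕ} (m : Finset.Icc 1 s) : ℝ := Real.logb 2 (m.val : ℝ)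

section Entropies

variable {κ : Type u} [Fintype κ] [DecidableEq κ]

/-- `S_-^ε(X)` with reference state `X_ref`: the supremum of `λ₁ - λ₂` subject to
`(X_ref, χ_{λ₁}) ≺^ε (X, χ_{λ₂})`, over meters of every dimension `s > 1`. -/
noncomputable def sMinus (Xref : DensityMatrix κ) (ε : ℝ) (X : DensityMatrix κ) : EReal :=
  sSup {x : EReal | ∃ (s : ℕ) (m₁ m₂ : Finset.Icc 1 s), 1 < s ∧
    DensityMatrix.SmoothMajorises ε
      (Xref.tensor (meterState s m₁)) (X.tensor (meterState s m₂)) ∧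
    x = ((meterParam m₁ - meterParam m₂ : ℝ) : EReal)}

/-- `S_+^ε(X)` with reference state `X_ref`: the infimum of `λ₂ - λ₁` subject to
`(X, χ_{λ₁}) ≺^ε (X_ref, χ_{λ₂})`, over meters of every dimension `s > 1`. -/
noncomputable def sPlus (Xref : DensityMatrix κ) (ε : ℝ) (X : DensityMatrix κ) : EReal :=
  sInf {x : EReal | ∃ (s : ℕ) (m₁ m₂ : Finset.Icc 1 s), 1 < s ∧
    DensityMatrix.SmoothMajorises ε
      (X.tensor (meterState s m₁)) (Xref.tensor (meterState s m₂)) ∧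
    x = ((meterParam m₂ - meterParam m₁ : ℝ) : EReal)}

/-- `τ = τ_l ∈ Γ_M`, that is, `S_-^0(τ) = S_+^0(τ) = l`. -/
def IsMeterLike (Xref τ : DensityMatrix κ) (l : ℝ) : Prop :=
  sMinus Xref 0 τ = (l : EReal) ∧ sPlus Xref 0 τ = (l : EReal)

end Entropies

section Macroscopic

variable {κ : ℝ≥0 → Type u} [∀ n, Fintype (κ n)] [∀ n, DecidableEq (κ n)]

/-- The macroscopic order relation `X_∞ ≺_∞ Y_∞`. -/
def MacroPrec (X Y : ∀ n, DensityMatrix (κ n)) : Prop :=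
  ∀ ε : ℝ, 0 < ε → ∃ n₀ : ℝ≥0, ∀ n, n₀ ≤ n → DensityMatrix.SmoothMajorises ε (X n) (Y n)

/-- The macroscopic state `X_∞` satisfies the defining condition of a thermodynamic equilibrium
state with parameter `l` (relative to the reference states `X_ref(n)`). -/
def IsEquilibriumWith (Xref X : ∀ n, DensityMatrix (κ n)) (l : ℝ) : Prop :=
  ∀ δ : ℝ, 0 < δ →
    ∃ (τm τp : ∀ n, DensityMatrix (κ n)) (lm lp : ℝ≥0 → ℝ),
      (∀ n, IsMeterLike (Xref n) (τm n) (lm n)) ∧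
      (∀ n, IsMeterLike (Xref n) (τp n) (lp n)) ∧
      MacroPrec τm X ∧ MacroPrec X τp ∧
      (∃ n₀ : ℝ≥0, ∀ n, n₀ ≤ n → (n : ℝ) * (l - δ) ≤ lm n) ∧
      (∃ n₀ : ℝ≥0, ∀ n, n₀ ≤ n → lp n ≤ (n : ℝ) * (l + δ))

/-- `X_∞` is a thermodynamic equilibrium state. -/
def IsThermodynamicEquilibrium (Xref X : ∀ n, DensityMatrix (κ n)) : Prop :=
  ∃ l : ℝ, IsEquilibriumWith Xref X l

end Macroscopic

/-- The state spaces are `Γ(n) = S((ℂ^ι)^{⊗⌈n⌉})`; this is the index set of the product basis. -/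
abbrev copies (ι : Type u) (n : ℝ≥0) : Type u := Fin ⌈n⌉₊ → ι

/-- The i.i.d. macroscopic state `n ↦ ρ^{⊗⌈n⌉}`. -/
noncomputable def iid {ι : Type u} [Fintype ι] [DecidableEq ι] (ρ : DensityMatrix ι) (n : ℝ≥0) :
    DensityMatrix (copies ι n) :=
  ρ.tensorPower ⌈n⌉₊

/-- The reference states `n ↦ |0…0⟩⟨0…0|`, where `|0⟩` is the basis vector with label `o`. -/
noncomputable def iidRef {ι : Type u} [Fintype ι] [DecidableEq ι] (o : ι) (n : ℝ≥0) :
    DensityMatrix (copies ι n) :=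
  DensityMatrix.pureState fun _ => o

end SmoothThermo

/-!
The orders involved only see spectra, so everything reduces to classical probability vectors.

*Spectra.* `HasSpectrum A p` says that `A` is diagonal with entries `p` in some orthonormal basis.
Two orthonormal bases differ by a unitary matrix whose squared moduli form a doubly stochastic
matrix, so the sum of the `k` largest eigenvalues is the maximum of `∑ w i * p i` over weights
`w i ∈ [0, 1]` of total weight at most `k` (`HasSpectrum.sum_mul_le_topSum`,
`HasSpectrum.exists_isWeight_topSum_eq`). The same argument shows that this sum is Lipschitz in the
trace distance (`abs_topSum_sub_le`); hence smooth majorisation preserves the majorisation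
inequalities up to an additive error (`topSum_le_of_smoothMajorises`).

*Meters.* Without smoothing, the lower entropy is at most the min-entropy, the upper entropy is at
least the logarithm of the rank, and both bounds are attained by flat states (uniform on a finite
set of basis vectors). So the flat states of rank `r` are meter-like with parameter `log₂ r`
(`isMeterLike_flatState`), and every meter-like state with parameter `l` has eigenvalues at most
`2 ^ (-l)` and rank at most `2 ^ l`.

*Equipartition.* The spectrum of `ρ^{⊗N}` is the product distribution. By a Chernoff bound, all but
a vanishing part of it sits on sequences of probability between `2 ^ (-N (H + δ))` and
`2 ^ (-N (H - δ))`. Cutting off the unlikely sequences leaves a state of rank at most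
`2 ^ (N (H + δ))`, which precedes the flat state on its support (`exists_macroPrec_flat`). Cutting
off the overly likely ones leaves a state of small maximal eigenvalue, which is preceded by a flat
state of rank about `2 ^ (N (H - δ))` (`exists_flat_macroPrec`). Hence `H` is a parameter.

*Uniqueness.* A meter-like state preceding `ρ^{⊗N}` with an entropy rate above `H` would have
eigenvalues too small for its `2 ^ (N (H + δ))` largest ones to carry the mass of the likely
sequences (`le_of_macroPrec_iid`); one preceded by `ρ^{⊗N}` with a rate below `H` would have a rank
too small to hold them (`le_of_iid_macroPrec`).
-/

namespace SmoothThermo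

/-! ### Spectra of Hermitian matrices -/

section Spectrum

variable {κ μ : Type*} [Fintype κ] [DecidableEq κ] [Fintype μ] [DecidableEq μ]

/-- `A` is unitarily equivalent to the diagonal matrix with entries `p`. Thus `p` lists the
eigenvalues of `A` with multiplicity, in an arbitrary order. -/
def HasSpectrum (A : Matrix κ κ ℂ) (p : κ → ℝ) : Prop :=
  ∃ U ∈ Matrix.unitaryGroup κ ℂ, A = U * Matrix.diagonal (fun i => (p i : ℂ)) * Uᴴ

theorem hasSpectrum_diagonal (p : κ → ℝ) :
    HasSpectrum (Matrix.diagonal fun i => (p i : ℂ)) p :=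
  ⟨1, one_mem _, by simp⟩

theorem hasSpectrum_eigenvalues {A : Matrix κ κ ℂ} (hA : A.IsHermitian) :
    HasSpectrum A hA.eigenvalues := by
  refine ⟨hA.eigenvectorUnitary, hA.eigenvectorUnitary.2, ?_⟩
  conv_lhs => rw [hA.spectral_theorem]
  rw [Unitary.conjStarAlgAut_apply]
  rfl

theorem HasSpectrum.kronecker {A : Matrix κ κ ℂ} {B : Matrix μ μ ℂ} {p : κ → ℝ} {q : μ → ℝ}
    (hA : HasSpectrum A p) (hB : HasSpectrum B q) :
    HasSpectrum (A ⊗ₖ B) (fun x => p x.1 * q x.2) := by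
  obtain ⟨U, hU, rfl⟩ := hA
  obtain ⟨V, hV, rfl⟩ := hB
  refine ⟨U ⊗ₖ V, Matrix.kronecker_mem_unitary hU hV, ?_⟩
  rw [Matrix.conjTranspose_kronecker, Matrix.mul_kronecker_mul, Matrix.mul_kronecker_mul,
    Matrix.diagonal_kronecker_diagonal]
  simp

theorem matrixTensorPower_mul {κ : Type*} [Fintype κ] (A B : Matrix κ κ ℂ) (N : ℕ) :
    DensityMatrix.matrixTensorPower (A * B) N =
      DensityMatrix.matrixTensorPower A N * DensityMatrix.matrixTensorPower B N := by
  ext x y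
  simp only [DensityMatrix.matrixTensorPower, Matrix.of_apply, Matrix.mul_apply,
    ← Finset.prod_mul_distrib]
  rw [Finset.prod_univ_sum, Fintype.piFinset_univ]

theorem matrixTensorPower_conjTranspose {κ : Type*} (A : Matrix κ κ ℂ) (N : ℕ) :
    DensityMatrix.matrixTensorPower Aᴴ N = (DensityMatrix.matrixTensorPower A N)ᴴ := by
  ext x y
  simp [DensityMatrix.matrixTensorPower]

theorem matrixTensorPower_diagonal {κ : Type*} [DecidableEq κ] (d : κ → ℂ) (N : ℕ) :
    DensityMatrix.matrixTensorPower (Matrix.diagonal d) N =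
      Matrix.diagonal fun x : Fin N → κ => ∏ i, d (x i) := by
  ext x y
  simp only [DensityMatrix.matrixTensorPower, Matrix.of_apply, Matrix.diagonal_apply]
  split_ifs with h
  · subst h; simp
  · obtain ⟨i, hi⟩ := Function.ne_iff.mp h
    exact Finset.prod_eq_zero (Finset.mem_univ i) (by simp [hi])

theorem HasSpectrum.matrixTensorPower {A : Matrix κ κ ℂ} {p : κ → ℝ} (hA : HasSpectrum A p)
    (N : ℕ) : HasSpectrum (DensityMatrix.matrixTensorPower A N) (fun x => ∏ i, p (x i)) := by
  obtain ⟨U, hU, rfl⟩ := hA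
  refine ⟨DensityMatrix.matrixTensorPower U N, ?_, ?_⟩
  · rw [Matrix.mem_unitaryGroup_iff, Matrix.star_eq_conjTranspose,
      ← matrixTensorPower_conjTranspose, ← matrixTensorPower_mul, ← Matrix.star_eq_conjTranspose,
      Matrix.mem_unitaryGroup_iff.mp hU, ← Matrix.diagonal_one, matrixTensorPower_diagonal]
    simp
  · rw [matrixTensorPower_mul, matrixTensorPower_mul, matrixTensorPower_conjTranspose,
      matrixTensorPower_diagonal]
    simp

/-- The squared moduli of the entries of a unitary matrix form a doubly stochastic matrix. -/
theorem normSq_mem_doublyStochastic {W : Matrix κ κ ℂ} (hW : W ∈ Matrix.unitaryGroup κ ℂ) :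
    (Matrix.of fun i j => Complex.normSq (W i j)) ∈ doublyStochastic ℝ κ := by
  rw [mem_doublyStochastic_iff_sum]
  refine ⟨fun i j => Complex.normSq_nonneg _, fun i => ?_, fun j => ?_⟩
  · have h := congrFun (congrFun (Matrix.mem_unitaryGroup_iff.mp hW) i) i
    simp only [Matrix.mul_apply, Matrix.star_apply, Complex.star_def, Complex.mul_conj,
      Matrix.one_apply_eq] at h
    exact_mod_cast h
  · have h := congrFun (congrFun (Matrix.mem_unitaryGroup_iff'.mp hW) j) j
    simp only [Matrix.mul_apply, Matrix.star_apply, Complex.star_def, mul_comm _ (W _ _),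
      Complex.mul_conj, Matrix.one_apply_eq] at h
    exact_mod_cast h

/-- The diagonal of a Hermitian matrix in any orthonormal basis is the image of its spectrum under
a doubly stochastic matrix (Schur). -/
theorem HasSpectrum.exists_doublyStochastic {A U : Matrix κ κ ℂ} {p : κ → ℝ}
    (hA : HasSpectrum A p) (hU : U ∈ Matrix.unitaryGroup κ ℂ) :
    ∃ P ∈ doublyStochastic ℝ κ, ∀ i, ((Uᴴ * A * U) i i).re = ∑ j, P i j * p j := by
  obtain ⟨V, hV, rfl⟩ := hA
  have hW : Uᴴ * V ∈ Matrix.unitaryGroup κ ℂ := by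
    rw [← Matrix.star_eq_conjTranspose]
    exact mul_mem (Unitary.star_mem hU) hV
  refine ⟨_, normSq_mem_doublyStochastic hW, fun i => ?_⟩
  have h : Uᴴ * (V * Matrix.diagonal (fun i => (p i : ℂ)) * Vᴴ) * U =
      (Uᴴ * V) * Matrix.diagonal (fun i => (p i : ℂ)) * (Uᴴ * V)ᴴ := by
    simp [Matrix.conjTranspose_mul, Matrix.mul_assoc]
  rw [h, Matrix.mul_apply, Complex.re_sum]
  refine Finset.sum_congr rfl fun j _ => ?_
  rw [Matrix.mul_diagonal, Matrix.conjTranspose_apply, Complex.star_def, mul_right_comm,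
    Complex.mul_conj, ← Complex.ofReal_mul, Complex.ofReal_re, Matrix.of_apply]

theorem conjTranspose_mul_conj_mul {U : Matrix κ κ ℂ} (hU : U ∈ Matrix.unitaryGroup κ ℂ)
    (D : Matrix κ κ ℂ) : Uᴴ * (U * D * Uᴴ) * U = D := by
  have hUU : Uᴴ * U = 1 := Matrix.mem_unitaryGroup_iff'.mp hU
  calc Uᴴ * (U * D * Uᴴ) * U = (Uᴴ * U) * D * (Uᴴ * U) := by simp only [Matrix.mul_assoc]
    _ = D := by rw [hUU, one_mul, mul_one]

/-- Any two spectra of the same matrix are related by a doubly stochastic matrix. -/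
theorem HasSpectrum.exists_doublyStochastic_eq {A : Matrix κ κ ℂ} {p q : κ → ℝ}
    (hp : HasSpectrum A p) (hq : HasSpectrum A q) :
    ∃ P ∈ doublyStochastic ℝ κ, ∀ i, q i = ∑ j, P i j * p j := by
  obtain ⟨U, hU, h⟩ := hq
  obtain ⟨P, hP, hPp⟩ := hp.exists_doublyStochastic hU
  refine ⟨P, hP, fun i => ?_⟩
  rw [← hPp, h, conjTranspose_mul_conj_mul hU]
  simp

theorem HasSpectrum.nonneg {ρ : DensityMatrix κ} {p : κ → ℝ} (h : HasSpectrum ρ.toMatrix p)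
    (i : κ) : 0 ≤ p i := by
  obtain ⟨P, hP, hPp⟩ := (hasSpectrum_eigenvalues ρ.isHermitian).exists_doublyStochastic_eq h
  rw [hPp]
  exact Finset.sum_nonneg fun j _ =>
    mul_nonneg (nonneg_of_mem_doublyStochastic hP) (ρ.posSemidef.eigenvalues_nonneg j)

theorem HasSpectrum.trace_eq {A : Matrix κ κ ℂ} {p : κ → ℝ} (h : HasSpectrum A p) :
    A.trace = ((∑ i, p i : ℝ) : ℂ) := by
  obtain ⟨U, hU, rfl⟩ := h
  rw [Matrix.trace_mul_cycle, ← Matrix.star_eq_conjTranspose, Matrix.mem_unitaryGroup_iff'.mp hU,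
    one_mul, Matrix.trace_diagonal, Complex.ofReal_sum]

theorem HasSpectrum.sum_eq_one {ρ : DensityMatrix κ} {p : κ → ℝ}
    (h : HasSpectrum ρ.toMatrix p) : ∑ i, p i = 1 := by
  have := h.trace_eq
  rw [ρ.trace_eq_one] at this
  exact_mod_cast this.symm

/-- The trace norm is at most the `ℓ¹` norm of any spectrum: a doubly stochastic matrix contracts
the `ℓ¹` norm. -/
theorem HasSpectrum.sum_abs_eigenvalues_le {A : Matrix κ κ ℂ} {p : κ → ℝ} (h : HasSpectrum A p)
    (hA : A.IsHermitian) : ∑ i, |hA.eigenvalues i| ≤ ∑ i, |p i| := by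
  obtain ⟨P, hP, hPp⟩ := h.exists_doublyStochastic_eq (hasSpectrum_eigenvalues hA)
  calc ∑ i, |hA.eigenvalues i| ≤ ∑ i, ∑ j, P i j * |p j| := by
        refine Finset.sum_le_sum fun i _ => ?_
        rw [hPp]
        refine (Finset.abs_sum_le_sum_abs _ _).trans (le_of_eq ?_)
        refine Finset.sum_congr rfl fun j _ => ?_
        rw [abs_mul, abs_of_nonneg (nonneg_of_mem_doublyStochastic hP)]
    _ = ∑ j, |p j| := by
        rw [Finset.sum_comm]
        refine Finset.sum_congr rfl fun j _ => ?_
        rw [← Finset.sum_mul, sum_col_of_mem_doublyStochastic hP, one_mul]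

theorem vonNeumannEntropy_eq (ρ : DensityMatrix κ) :
    ρ.vonNeumannEntropy =
      -∑ i, ρ.isHermitian.eigenvalues i * Real.logb 2 (ρ.isHermitian.eigenvalues i) := by
  have h : HasSpectrum (ρ.toMatrix * cfc (Real.logb 2) ρ.toMatrix)
      (fun i => ρ.isHermitian.eigenvalues i * Real.logb 2 (ρ.isHermitian.eigenvalues i)) := by
    refine ⟨ρ.isHermitian.eigenvectorUnitary, ρ.isHermitian.eigenvectorUnitary.2, ?_⟩
    rw [ρ.isHermitian.cfc_eq, Matrix.IsHermitian.cfc]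
    conv_lhs => enter [1]; rw [ρ.isHermitian.spectral_theorem]
    rw [← map_mul, Matrix.diagonal_mul_diagonal, Unitary.conjStarAlgAut_apply]
    simp [Matrix.star_eq_conjTranspose]
  rw [DensityMatrix.vonNeumannEntropy, h.trace_eq, Complex.ofReal_re]

end Spectrum

/-! ### The sum of the largest eigenvalues -/

section TopSum

variable {κ : Type*} [Fintype κ]

/-- A fractional choice of at most `k` indices: weights in `[0, 1]` of total weight at most `k`. -/
structure IsWeight (k : ℕ) (w : κ → ℝ) : Prop where
  nonneg : ∀ i, 0 ≤ w i
  le_one : ∀ i, w i ≤ 1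
  sum_le : ∑ i, w i ≤ k

theorem isWeight_indicator [DecidableEq κ] {S : Finset κ} {k : ℕ} (hS : S.card ≤ k) :
    IsWeight k fun i => if i ∈ S then (1 : ℝ) else 0 where
  nonneg i := by split_ifs <;> norm_num
  le_one i := by split_ifs <;> norm_num
  sum_le := by simpa using hS

theorem IsWeight.sum_mul_le_sum {k : ℕ} {w p : κ → ℝ} (hw : IsWeight k w) (hp : ∀ i, 0 ≤ p i) :
    ∑ i, w i * p i ≤ ∑ i, p i :=
  Finset.sum_le_sum fun i _ => mul_le_of_le_one_left (hp i) (hw.le_one i)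

theorem IsWeight.sum_mul_le_mul {k : ℕ} {w p : κ → ℝ} (hw : IsWeight k w) {M : ℝ} (hM : 0 ≤ M)
    (hp : ∀ i, p i ≤ M) : ∑ i, w i * p i ≤ k * M :=
  calc ∑ i, w i * p i ≤ ∑ i, w i * M :=
        Finset.sum_le_sum fun i _ => mul_le_mul_of_nonneg_left (hp i) (hw.nonneg i)
    _ ≤ k * M := by
        rw [← Finset.sum_mul]
        exact mul_le_mul_of_nonneg_right hw.sum_le hM

/-- Splitting at the threshold `M`: the entries above `M` are taken in full, the `k` units of weight
collect at most `M` each from the rest. -/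
theorem IsWeight.sum_mul_le_add {k : ℕ} {w p : κ → ℝ} (hw : IsWeight k w) (hp : ∀ i, 0 ≤ p i)
    {M : ℝ} (hM : 0 ≤ M) :
    ∑ i, w i * p i ≤ (∑ i with M < p i, p i) + k * M := by
  classical
  calc ∑ i, w i * p i ≤ ∑ i, ((if M < p i then p i else 0) + w i * min (p i) M) := by
        refine Finset.sum_le_sum fun i _ => ?_
        split_ifs with h
        · rw [min_eq_right h.le]
          have := mul_le_of_le_one_left (hp i) (hw.le_one i)
          have := mul_nonneg (hw.nonneg i) hM
          linarith
        · rw [min_eq_left (not_lt.mp h), zero_add]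
    _ ≤ _ := by
        rw [Finset.sum_add_distrib, ← Finset.sum_filter]
        exact add_le_add le_rfl (hw.sum_mul_le_mul hM fun i => min_le_right _ _)

/-- Among all weights, the first `k` entries of a nonnegative decreasing list carry the most. -/
theorem IsWeight.sum_mul_le_of_antitone {n k : ℕ} {e w : Fin n → ℝ} (hw : IsWeight k w)
    (he : Antitone e) (he0 : ∀ i, 0 ≤ e i) :
    ∑ i, w i * e i ≤ ∑ i : Fin n with i.val < k, e i := by
  -- the threshold `t` separates the first `k` entries from the rest
  obtain ⟨t, ht0, ht1, ht2, ht3⟩ : ∃ t : ℝ, 0 ≤ t ∧ (∀ i, i.val < k → t ≤ e i) ∧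
      (∀ i, k ≤ i.val → e i ≤ t) ∧ t * ∑ i, w i ≤ t * ∑ i : Fin n with i.val < k, 1 := by
    by_cases hk : k < n
    · refine ⟨e ⟨k, hk⟩, he0 _, fun i hi => he (Fin.le_def.mpr hi.le),
        fun i hi => he (Fin.le_def.mpr hi), mul_le_mul_of_nonneg_left ?_ (he0 _)⟩
      rw [Finset.sum_const, Fin.card_filter_val_lt, min_eq_right hk.le]
      simpa using hw.sum_le
    · exact ⟨0, le_rfl, fun i _ => he0 i, fun i hi => absurd i.2 (by omega), by simp⟩
  have h : 0 ≤ ∑ i : Fin n, ((if i.val < k then 1 else 0) - w i) * (e i - t) := by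
    refine Finset.sum_nonneg fun i _ => ?_
    split_ifs with hi
    · exact mul_nonneg (sub_nonneg.mpr (hw.le_one i)) (sub_nonneg.mpr (ht1 i hi))
    · exact mul_nonneg_of_nonpos_of_nonpos (by linarith [hw.nonneg i])
        (sub_nonpos.mpr (ht2 i (not_lt.mp hi)))
  have h2 : ∑ i : Fin n, ((if i.val < k then 1 else 0) - w i) * (e i - t) =
      (∑ i : Fin n with i.val < k, e i) - ∑ i, w i * e i
        - (t * (∑ i : Fin n with i.val < k, 1) - t * ∑ i, w i) := by
    simp only [Finset.sum_filter, Finset.mul_sum, ← Finset.sum_sub_distrib]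
    refine Finset.sum_congr rfl fun i _ => ?_
    split_ifs <;> ring
  linarith

variable [DecidableEq κ]

theorem topSum_eq_sum_eigenvalues (ρ : DensityMatrix κ) (k : ℕ) :
    ρ.topSum k = ∑ i : κ with
      ((Fintype.equivOfCardEq (Fintype.card_fin _)).symm i : Fin (Fintype.card κ)).val < k,
        ρ.isHermitian.eigenvalues i := by
  rw [DensityMatrix.topSum, Finset.sum_filter, Finset.sum_filter,
    ← Equiv.sum_comp (Fintype.equivOfCardEq (Fintype.card_fin (Fintype.card κ)))]
  simp [Matrix.IsHermitian.eigenvalues]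

/-- Ky Fan's inequality: weighted diagonal entries, in any orthonormal basis, are dominated by the
largest eigenvalues. -/
theorem IsWeight.sum_mul_diag_le_topSum {k : ℕ} {w : κ → ℝ} (hw : IsWeight k w)
    (ρ : DensityMatrix κ) {U : Matrix κ κ ℂ} (hU : U ∈ Matrix.unitaryGroup κ ℂ) :
    ∑ i, w i * ((Uᴴ * ρ.toMatrix * U) i i).re ≤ ρ.topSum k := by
  obtain ⟨P, hP, hPp⟩ := (hasSpectrum_eigenvalues ρ.isHermitian).exists_doublyStochastic hU
  set c : Fin (Fintype.card κ) ≃ κ := Fintype.equivOfCardEq (Fintype.card_fin _) with hc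
  have h0 : ∀ i j, 0 ≤ P i j := fun i j => nonneg_of_mem_doublyStochastic hP
  have hw' : IsWeight k fun a : Fin (Fintype.card κ) => ∑ i, w i * P i (c a) := by
    refine ⟨fun a => Finset.sum_nonneg fun i _ => mul_nonneg (hw.nonneg i) (h0 _ _), fun a => ?_, ?_⟩
    · rw [← sum_col_of_mem_doublyStochastic hP (c a)]
      exact Finset.sum_le_sum fun i _ => mul_le_of_le_one_left (h0 _ _) (hw.le_one i)
    · rw [Equiv.sum_comp c (fun j => ∑ i, w i * P i j), Finset.sum_comm]
      simp only [← Finset.mul_sum, sum_row_of_mem_doublyStochastic hP, mul_one]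
      exact hw.sum_le
  have hpos : ∀ a, 0 ≤ ρ.isHermitian.eigenvalues₀ a := fun a => by
    have := ρ.posSemidef.eigenvalues_nonneg (c a)
    simpa [Matrix.IsHermitian.eigenvalues, hc] using this
  refine le_trans (le_of_eq ?_)
    (hw'.sum_mul_le_of_antitone ρ.isHermitian.eigenvalues₀_antitone hpos)
  rw [← Equiv.sum_comp c.symm]
  simp only [Equiv.apply_symm_apply, Finset.sum_mul]
  rw [Finset.sum_comm]
  refine Finset.sum_congr rfl fun i _ => ?_
  rw [hPp, Finset.mul_sum]
  exact Finset.sum_congr rfl fun j _ => by rw [mul_assoc]; rfl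

theorem HasSpectrum.sum_mul_le_topSum {ρ : DensityMatrix κ} {p : κ → ℝ}
    (h : HasSpectrum ρ.toMatrix p) {k : ℕ} {w : κ → ℝ} (hw : IsWeight k w) :
    ∑ i, w i * p i ≤ ρ.topSum k := by
  obtain ⟨U, hU, hA⟩ := h
  have h' : Uᴴ * ρ.toMatrix * U = Matrix.diagonal fun i => (p i : ℂ) := by
    rw [hA, conjTranspose_mul_conj_mul hU]
  simpa [h'] using hw.sum_mul_diag_le_topSum ρ hU

theorem HasSpectrum.sum_le_topSum {ρ : DensityMatrix κ} {p : κ → ℝ}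
    (h : HasSpectrum ρ.toMatrix p) {k : ℕ} {S : Finset κ} (hS : S.card ≤ k) :
    ∑ i ∈ S, p i ≤ ρ.topSum k := by
  simpa using h.sum_mul_le_topSum (isWeight_indicator hS)

/-- The bound of `HasSpectrum.sum_mul_le_topSum` is attained. -/
theorem HasSpectrum.exists_isWeight_topSum_eq {ρ : DensityMatrix κ} {p : κ → ℝ}
    (h : HasSpectrum ρ.toMatrix p) (k : ℕ) :
    ∃ w, IsWeight k w ∧ ρ.topSum k = ∑ i, w i * p i := by
  obtain ⟨P, hP, hPp⟩ := h.exists_doublyStochastic_eq (hasSpectrum_eigenvalues ρ.isHermitian)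
  rw [topSum_eq_sum_eigenvalues]
  set S : Finset κ := {i : κ | ((Fintype.equivOfCardEq (Fintype.card_fin _)).symm i :
    Fin (Fintype.card κ)).val < k} with hS
  have hcard : S.card ≤ k := by
    calc S.card ≤ (Finset.range k).card := by
          refine Finset.card_le_card_of_injOn
            (fun i => ((Fintype.equivOfCardEq (Fintype.card_fin _)).symm i :
              Fin (Fintype.card κ)).val) (fun i hi => ?_) ?_
          · simpa [hS] using hi
          · exact fun i _ j _ hij => (Equiv.injective _) (Fin.val_injective hij)
      _ = k := Finset.card_range k
  have h0 : ∀ i j, 0 ≤ P i j := fun i j => nonneg_of_mem_doublyStochastic hP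
  refine ⟨fun j => ∑ i ∈ S, P i j, ⟨fun j => Finset.sum_nonneg fun i _ => h0 i j, fun j => ?_, ?_⟩,
    ?_⟩
  · rw [← sum_col_of_mem_doublyStochastic hP j]
    exact Finset.sum_le_univ_sum_of_nonneg fun i => h0 i j
  · rw [Finset.sum_comm]
    simp only [sum_row_of_mem_doublyStochastic hP]
    simpa using hcard
  · simp only [Finset.sum_mul]
    rw [Finset.sum_comm]
    exact Finset.sum_congr rfl fun i _ => hPp i

theorem HasSpectrum.topSum_le_mul {ρ : DensityMatrix κ} {p : κ → ℝ}
    (h : HasSpectrum ρ.toMatrix p) {M : ℝ} (hM : 0 ≤ M) (hp : ∀ i, p i ≤ M) (k : ℕ) :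
    ρ.topSum k ≤ k * M := by
  obtain ⟨w, hw, hk⟩ := h.exists_isWeight_topSum_eq k
  exact hk ▸ hw.sum_mul_le_mul hM hp

theorem topSum_le_one (ρ : DensityMatrix κ) (k : ℕ) : ρ.topSum k ≤ 1 := by
  have h := hasSpectrum_eigenvalues ρ.isHermitian
  obtain ⟨w, hw, hk⟩ := h.exists_isWeight_topSum_eq k
  rw [hk, ← h.sum_eq_one]
  exact hw.sum_mul_le_sum h.nonneg

/-- If `k` eigenvalues carry the whole trace, then the rank is at most `k`. -/
theorem HasSpectrum.card_support_le {ρ : DensityMatrix κ} {p : κ → ℝ}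
    (h : HasSpectrum ρ.toMatrix p) {k : ℕ} (hk : 1 ≤ ρ.topSum k) :
    (Finset.univ.filter fun i => p i ≠ 0).card ≤ k := by
  obtain ⟨w, hw, hkw⟩ := h.exists_isWeight_topSum_eq k
  have h1 : ∑ i, (1 - w i) * p i ≤ 0 := by
    simp only [sub_mul, one_mul, Finset.sum_sub_distrib, h.sum_eq_one]
    linarith
  have h2 : ∀ i, 0 ≤ (1 - w i) * p i :=
    fun i => mul_nonneg (sub_nonneg.mpr (hw.le_one i)) (h.nonneg i)
  have h3 : ∀ i, p i ≠ 0 → w i = 1 := fun i hi => by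
    have := (Finset.sum_eq_zero_iff_of_nonneg fun i _ => h2 i).mp
      (le_antisymm h1 (Finset.sum_nonneg fun i _ => h2 i)) i (Finset.mem_univ i)
    rcases mul_eq_zero.mp this with h | h
    · linarith
    · exact absurd h hi
  have h4 : ((Finset.univ.filter fun i => p i ≠ 0).card : ℝ) ≤ k := by
    refine le_trans ?_ hw.sum_le
    calc ((Finset.univ.filter fun i => p i ≠ 0).card : ℝ)
        = ∑ i with p i ≠ 0, w i := by
          rw [Finset.sum_congr rfl fun i hi => h3 i (Finset.mem_filter.mp hi).2]
          simp
      _ ≤ ∑ i, w i := Finset.sum_le_univ_sum_of_nonneg hw.nonneg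
  exact_mod_cast h4

end TopSum

/-! ### Trace distance and smoothing -/

section TraceDist

variable {κ : Type*} [Fintype κ] [DecidableEq κ]

theorem abs_sum_mul_diag_sub_le_traceDist (ρ σ : DensityMatrix κ) {k : ℕ} {w : κ → ℝ}
    (hw : IsWeight k w) {U : Matrix κ κ ℂ} (hU : U ∈ Matrix.unitaryGroup κ ℂ) :
    |∑ i, w i * ((Uᴴ * ρ.toMatrix * U) i i).re - ∑ i, w i * ((Uᴴ * σ.toMatrix * U) i i).re| ≤
      2 * ρ.traceDist σ := by
  have hH := ρ.isHermitian.sub σ.isHermitian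
  obtain ⟨P, hP, hPp⟩ := (hasSpectrum_eigenvalues hH).exists_doublyStochastic hU
  have h0 : ∀ i j, 0 ≤ P i j := fun i j => nonneg_of_mem_doublyStochastic hP
  have h : ∑ i, w i * ((Uᴴ * ρ.toMatrix * U) i i).re - ∑ i, w i * ((Uᴴ * σ.toMatrix * U) i i).re =
      ∑ i, w i * ∑ j, P i j * hH.eigenvalues j := by
    rw [← Finset.sum_sub_distrib]
    refine Finset.sum_congr rfl fun i _ => ?_
    rw [← hPp, Matrix.mul_sub, Matrix.sub_mul, Matrix.sub_apply, Complex.sub_re, mul_sub]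
  rw [h, DensityMatrix.traceDist]
  calc |∑ i, w i * ∑ j, P i j * hH.eigenvalues j|
      ≤ ∑ i, |w i * ∑ j, P i j * hH.eigenvalues j| := Finset.abs_sum_le_sum_abs _ _
    _ ≤ ∑ i, ∑ j, P i j * |hH.eigenvalues j| := by
        refine Finset.sum_le_sum fun i _ => ?_
        rw [abs_mul, abs_of_nonneg (hw.nonneg i)]
        refine (mul_le_of_le_one_left (abs_nonneg _) (hw.le_one i)).trans ?_
        refine (Finset.abs_sum_le_sum_abs _ _).trans (le_of_eq ?_)
        exact Finset.sum_congr rfl fun j _ => by rw [abs_mul, abs_of_nonneg (h0 i j)]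
    _ = 2 * (1 / 2 * ∑ j, |hH.eigenvalues j|) := by
        rw [Finset.sum_comm]
        simp only [← Finset.sum_mul, sum_col_of_mem_doublyStochastic hP, one_mul]
        ring

/-- In a suitable orthonormal basis the sum of the `k` largest eigenvalues is a weighted sum of
diagonal entries. -/
theorem exists_topSum_eq_sum_diag (ρ : DensityMatrix κ) (k : ℕ) :
    ∃ U ∈ Matrix.unitaryGroup κ ℂ, ∃ w : κ → ℝ, IsWeight k w ∧
      ρ.topSum k = ∑ i, w i * ((Uᴴ * ρ.toMatrix * U) i i).re := by
  obtain ⟨U, hU, hA⟩ := hasSpectrum_eigenvalues ρ.isHermitian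
  obtain ⟨w, hw, hk⟩ := (hasSpectrum_eigenvalues ρ.isHermitian).exists_isWeight_topSum_eq k
  refine ⟨U, hU, w, hw, ?_⟩
  have h' : Uᴴ * ρ.toMatrix * U =
      Matrix.diagonal fun i => (ρ.isHermitian.eigenvalues i : ℂ) := by
    conv_lhs => rw [hA]
    exact conjTranspose_mul_conj_mul hU _
  simpa [h'] using hk

/-- The sum of the `k` largest eigenvalues is Lipschitz in the trace distance. -/
theorem abs_topSum_sub_le (ρ σ : DensityMatrix κ) (k : ℕ) :
    |ρ.topSum k - σ.topSum k| ≤ 2 * ρ.traceDist σ := by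
  obtain ⟨U, hU, w, hw, hk⟩ := exists_topSum_eq_sum_diag ρ k
  obtain ⟨V, hV, v, hv, hk'⟩ := exists_topSum_eq_sum_diag σ k
  have h1 := (abs_le.mp (abs_sum_mul_diag_sub_le_traceDist ρ σ hw hU)).2
  have h2 := (abs_le.mp (abs_sum_mul_diag_sub_le_traceDist ρ σ hv hV)).1
  have h3 := hw.sum_mul_diag_le_topSum σ hU
  have h4 := hv.sum_mul_diag_le_topSum ρ hV
  rw [abs_le]
  constructor <;> linarith

/-- Smooth majorisation keeps the majorisation inequalities up to an additive error. -/
theorem topSum_le_of_smoothMajorises {ε : ℝ} {ρ σ : DensityMatrix κ}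
    (h : DensityMatrix.SmoothMajorises ε ρ σ) {k : ℕ} (hk : 1 ≤ k) (hk' : k ≤ Fintype.card κ) :
    σ.topSum k ≤ ρ.topSum k + 2 * ε := by
  obtain ⟨ρ', σ', ε', ε'', hM, h1, h2, h3⟩ := h
  have h4 := hM k hk hk'
  have h5 := (abs_le.mp (abs_topSum_sub_le ρ ρ' k)).1
  have h6 := (abs_le.mp (abs_topSum_sub_le σ σ' k)).2
  have h7 : ρ.traceDist ρ' ≤ ε' := h1
  have h8 : σ.traceDist σ' ≤ ε'' := h2
  linarith

/-- A state may be perturbed within its eigenbasis; the trace distance is then at most the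
distance of the spectra in total variation. -/
theorem HasSpectrum.exists_traceDist_le {ρ : DensityMatrix κ} {p q : κ → ℝ}
    (h : HasSpectrum ρ.toMatrix p) (hq : ∀ i, 0 ≤ q i) (hq1 : ∑ i, q i = 1) :
    ∃ σ : DensityMatrix κ, HasSpectrum σ.toMatrix q ∧
      ρ.traceDist σ ≤ 1 / 2 * ∑ i, |p i - q i| := by
  obtain ⟨U, hU, hA⟩ := h
  have hspec : HasSpectrum (U * Matrix.diagonal (fun i => (q i : ℂ)) * Uᴴ) q := ⟨U, hU, rfl⟩
  refine ⟨⟨U * Matrix.diagonal (fun i => (q i : ℂ)) * Uᴴ, ?_, ?_⟩, hspec, ?_⟩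
  · refine Matrix.PosSemidef.mul_mul_conjTranspose_same (Matrix.PosSemidef.diagonal fun i => ?_) U
    exact Complex.zero_le_real.mpr (hq i)
  · rw [hspec.trace_eq, hq1, Complex.ofReal_one]
  · refine mul_le_mul_of_nonneg_left (HasSpectrum.sum_abs_eigenvalues_le ?_ _) (by norm_num)
    refine ⟨U, hU, ?_⟩
    change ρ.toMatrix - U * Matrix.diagonal (fun i => (q i : ℂ)) * Uᴴ = _
    conv_lhs => rw [hA]
    rw [← Matrix.sub_mul, ← Matrix.mul_sub, Matrix.diagonal_sub]
    simp

theorem traceDist_self_le (ρ : DensityMatrix κ) : ρ.traceDist ρ ≤ 0 := by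
  have h : HasSpectrum (ρ.toMatrix - ρ.toMatrix) (fun _ => (0 : ℝ)) := by
    rw [sub_self]
    exact ⟨1, one_mem _, by simp⟩
  have := h.sum_abs_eigenvalues_le (ρ.isHermitian.sub ρ.isHermitian)
  simp only [abs_zero, Finset.sum_const_zero] at this
  exact mul_nonpos_of_nonneg_of_nonpos (by norm_num) this

theorem DensityMatrix.Majorises.smoothMajorises_zero {ρ σ : DensityMatrix κ}
    (h : ρ.Majorises σ) : DensityMatrix.SmoothMajorises 0 ρ σ :=
  ⟨ρ, σ, 0, 0, h, traceDist_self_le ρ, traceDist_self_le σ, by norm_num⟩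

end TraceDist

/-! ### Flat states and meters -/

section Flat

variable {κ μ : Type*} [Fintype κ] [DecidableEq κ] [Fintype μ] [DecidableEq μ]

/-- The uniform probability distribution on a finite set. -/
noncomputable def flat {κ : Type*} [DecidableEq κ] (S : Finset κ) : κ → ℝ :=
  fun i => if i ∈ S then (S.card : ℝ)⁻¹ else 0

theorem flat_nonneg {κ : Type*} [DecidableEq κ] (S : Finset κ) (i : κ) : 0 ≤ flat S i := by
  unfold flat
  split_ifs <;> positivity

theorem flat_le {κ : Type*} [DecidableEq κ] (S : Finset κ) (i : κ) :
    flat S i ≤ (S.card : ℝ)⁻¹ := by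
  unfold flat
  split_ifs
  · exact le_rfl
  · positivity

theorem sum_flat_of_subset {κ : Type*} [DecidableEq κ] {S T : Finset κ} (h : T ⊆ S) :
    ∑ i ∈ T, flat S i = T.card * (S.card : ℝ)⁻¹ := by
  have : ∀ i ∈ T, flat S i = (S.card : ℝ)⁻¹ := fun i hi => if_pos (h hi)
  rw [Finset.sum_congr rfl this, Finset.sum_const, nsmul_eq_mul]

theorem card_mul_inv_card {κ : Type*} {S : Finset κ} (hS : S.Nonempty) :
    (S.card : ℝ) * (S.card : ℝ)⁻¹ = 1 :=
  mul_inv_cancel₀ (by exact_mod_cast hS.card_ne_zero)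

theorem sum_flat {S : Finset κ} (hS : S.Nonempty) : ∑ i, flat S i = 1 := by
  rw [← card_mul_inv_card hS, ← sum_flat_of_subset (Finset.Subset.refl S)]
  refine (Finset.sum_subset (Finset.subset_univ S) fun i _ hi => if_neg hi).symm

theorem flat_mul_flat {κ μ : Type*} [DecidableEq κ] [DecidableEq μ] (S : Finset κ) (T : Finset μ) :
    (fun x : κ × μ => flat S x.1 * flat T x.2) = flat (S ×ˢ T) := by
  ext x
  simp only [flat, Finset.mem_product, Finset.card_product]
  by_cases h1 : x.1 ∈ S <;> by_cases h2 : x.2 ∈ T <;> simp [h1, h2, mul_comm]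

/-- The state whose matrix is diagonal with the uniform distribution on `S` as its diagonal. -/
noncomputable def flatState (S : Finset κ) (hS : S.Nonempty) : DensityMatrix κ where
  toMatrix := Matrix.diagonal fun i => (flat S i : ℂ)
  posSemidef := Matrix.PosSemidef.diagonal fun i => Complex.zero_le_real.mpr (flat_nonneg S i)
  trace_eq_one := by
    rw [Matrix.trace_diagonal, ← Complex.ofReal_sum, sum_flat hS, Complex.ofReal_one]

theorem hasSpectrum_flatState (S : Finset κ) (hS : S.Nonempty) :
    HasSpectrum (flatState S hS).toMatrix (flat S) :=
  hasSpectrum_diagonal _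

theorem hasSpectrum_pureState (o : κ) :
    HasSpectrum (DensityMatrix.pureState o).toMatrix (flat {o}) := by
  convert hasSpectrum_diagonal (flat {o}) using 1
  simp only [DensityMatrix.pureState, flat, Finset.mem_singleton, Finset.card_singleton]
  congr 1
  ext i
  split_ifs <;> simp

/-- The basis vectors that span the support of a meter state. -/
def meterSupport (s : ℕ) (m : Finset.Icc 1 s) : Finset (Fin s) :=
  Finset.univ.filter fun i => i.val < m.val

theorem card_meterSupport (s : ℕ) (m : Finset.Icc 1 s) : (meterSupport s m).card = m.val := by
  rw [meterSupport, Fin.card_filter_val_lt, min_eq_right (Finset.mem_Icc.mp m.2).2]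

theorem one_le_meter {s : ℕ} (m : Finset.Icc 1 s) : 1 ≤ m.val :=
  (Finset.mem_Icc.mp m.2).1

theorem hasSpectrum_meterState (s : ℕ) (m : Finset.Icc 1 s) :
    HasSpectrum (meterState s m).toMatrix (flat (meterSupport s m)) := by
  convert hasSpectrum_diagonal (flat (meterSupport s m)) using 1
  simp only [meterState, flat, card_meterSupport]
  congr 1
  ext i
  simp only [meterSupport, Finset.mem_filter, Finset.mem_univ, true_and]
  split_ifs <;> simp

theorem HasSpectrum.tensor {ρ : DensityMatrix κ} {σ : DensityMatrix μ} {p : κ → ℝ} {q : μ → ℝ}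
    (hρ : HasSpectrum ρ.toMatrix p) (hσ : HasSpectrum σ.toMatrix q) :
    HasSpectrum (ρ.tensor σ).toMatrix (fun x => p x.1 * q x.2) :=
  hρ.kronecker hσ

theorem HasSpectrum.tensor_flat {ρ : DensityMatrix κ} {σ : DensityMatrix μ} {S : Finset κ}
    {T : Finset μ} (hρ : HasSpectrum ρ.toMatrix (flat S)) (hσ : HasSpectrum σ.toMatrix (flat T)) :
    HasSpectrum (ρ.tensor σ).toMatrix (flat (S ×ˢ T)) :=
  flat_mul_flat S T ▸ hρ.tensor hσ

/-- A flat state majorises every state whose eigenvalues do not exceed its own. -/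
theorem HasSpectrum.majorises_of_le {ρ σ : DensityMatrix κ} {S : Finset κ} {q : κ → ℝ}
    (hρ : HasSpectrum ρ.toMatrix (flat S)) (hS : S.Nonempty) (hσ : HasSpectrum σ.toMatrix q)
    (hq : ∀ i, q i ≤ (S.card : ℝ)⁻¹) : ρ.Majorises σ := by
  intro k _ _
  rcases le_total k S.card with hk | hk
  · obtain ⟨T, hTS, rfl⟩ := Finset.exists_subset_card_eq hk
    exact (hσ.topSum_le_mul (by positivity) hq _).trans
      (sum_flat_of_subset hTS ▸ hρ.sum_le_topSum le_rfl)
  · refine (topSum_le_one σ k).trans ?_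
    have := hρ.sum_le_topSum hk
    rwa [sum_flat_of_subset (Finset.Subset.refl S), card_mul_inv_card hS] at this

/-- A flat state is majorised by every state whose rank does not exceed its own. -/
theorem HasSpectrum.majorises_of_support_subset {ρ σ : DensityMatrix κ} {S : Finset κ} {p : κ → ℝ}
    (hρ : HasSpectrum ρ.toMatrix p) (hp : ∀ i, i ∉ S → p i = 0) (hS : S.Nonempty)
    (hσ : HasSpectrum σ.toMatrix (flat S)) : ρ.Majorises σ := by
  have hsum : ∑ i ∈ S, p i = 1 := by
    rw [← hρ.sum_eq_one]
    exact Finset.sum_subset (Finset.subset_univ S) fun i _ hi => hp i hi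
  intro k _ _
  rcases le_total k S.card with hk | hk
  · have hc : (0 : ℝ) < S.card := by exact_mod_cast hS.card_pos
    have hw : IsWeight k fun i => if i ∈ S then (k : ℝ) * (S.card : ℝ)⁻¹ else 0 := by
      refine ⟨fun i => by split_ifs <;> positivity, fun i => ?_, ?_⟩
      · split_ifs
        · rw [← div_eq_mul_inv, div_le_one hc]
          exact_mod_cast hk
        · exact zero_le_one
      · rw [Finset.sum_ite_mem, Finset.univ_inter, Finset.sum_const, nsmul_eq_mul]
        exact le_of_eq (by field_simp)
    refine (hσ.topSum_le_mul (by positivity) (flat_le S) k).trans ?_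
    refine le_trans (le_of_eq ?_) (hρ.sum_mul_le_topSum hw)
    simp only [ite_mul, zero_mul]
    rw [Finset.sum_ite_mem, Finset.univ_inter, ← Finset.mul_sum, hsum, mul_one]
  · refine (topSum_le_one σ k).trans ?_
    rw [← hsum]
    exact hρ.sum_le_topSum hk

/-- The lower entropy is at most the min-entropy. -/
theorem HasSpectrum.sMinus_le {τ : DensityMatrix κ} {p : κ → ℝ} (h : HasSpectrum τ.toMatrix p)
    (o : κ) {i : κ} (hi : 0 < p i) :
    sMinus (DensityMatrix.pureState o) 0 τ ≤ ((-Real.logb 2 (p i) : ℝ) : EReal) := by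
  refine sSup_le ?_
  rintro x ⟨s, m₁, m₂, hs, hM, rfl⟩
  have h1 : (0 : ℝ) < m₁.val := by exact_mod_cast one_le_meter m₁
  have h2 : (0 : ℝ) < m₂.val := by exact_mod_cast one_le_meter m₂
  have hcard : 1 ≤ Fintype.card (κ × Fin s) :=
    Fintype.card_pos_iff.mpr ⟨(o, ⟨0, by omega⟩)⟩
  have h3 := topSum_le_of_smoothMajorises hM le_rfl hcard
  have h4 := ((hasSpectrum_pureState o).tensor_flat (hasSpectrum_meterState s m₁)).topSum_le_mul
    (by positivity) (flat_le _) 1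
  have h5 := (h.tensor (hasSpectrum_meterState s m₂)).sum_le_topSum (k := 1)
    (S := {(i, ⟨0, by omega⟩)}) (by simp)
  have h6 : flat (meterSupport s m₂) ⟨0, by omega⟩ = (m₂.val : ℝ)⁻¹ := by
    rw [flat, card_meterSupport, if_pos]
    exact Finset.mem_filter.mpr ⟨Finset.mem_univ _, one_le_meter m₂⟩
  simp only [Finset.sum_singleton, Finset.card_product, Finset.card_singleton, card_meterSupport,
    one_mul, Nat.cast_one, h6] at h4 h5
  have h7 : p i * (m₂.val : ℝ)⁻¹ ≤ (m₁.val : ℝ)⁻¹ := by linarith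
  have h8 := Real.logb_le_logb_of_le (b := 2) (by norm_num) (by positivity) h7
  rw [Real.logb_mul hi.ne' (by positivity), Real.logb_inv, Real.logb_inv] at h8
  rw [EReal.coe_le_coe_iff, meterParam, meterParam]
  linarith

/-- The upper entropy is at least the logarithm of the rank. -/
theorem HasSpectrum.le_sPlus {τ : DensityMatrix κ} {p : κ → ℝ} (h : HasSpectrum τ.toMatrix p)
    (o : κ) :
    ((Real.logb 2 (Finset.univ.filter fun i => p i ≠ 0).card : ℝ) : EReal) ≤
      sPlus (DensityMatrix.pureState o) 0 τ := by
  have hpos : 0 < (Finset.univ.filter fun i => p i ≠ 0).card := by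
    rw [Finset.card_pos]
    by_contra hne
    have := h.sum_eq_one
    rw [Finset.sum_eq_zero] at this
    · exact zero_ne_one this
    · intro i _
      by_contra hi
      exact hne ⟨i, by simpa using hi⟩
  refine le_sInf ?_
  rintro x ⟨s, m₁, m₂, hs, hM, rfl⟩
  have h1 : (0 : ℝ) < m₁.val := by exact_mod_cast one_le_meter m₁
  have h0 : (0 : ℝ) < (Finset.univ.filter fun i => p i ≠ 0).card := by exact_mod_cast hpos
  have hcard : m₂.val ≤ Fintype.card (κ × Fin s) := by
    rw [Fintype.card_prod, Fintype.card_fin]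
    exact (Finset.mem_Icc.mp m₂.2).2.trans
      (Nat.le_mul_of_pos_left s (Fintype.card_pos_iff.mpr ⟨o⟩))
  have h3 := topSum_le_of_smoothMajorises hM (one_le_meter m₂) hcard
  have hc : ({o} ×ˢ meterSupport s m₂ : Finset (κ × Fin s)).card = m₂.val := by
    simp [card_meterSupport]
  have hne : ({o} ×ˢ meterSupport s m₂ : Finset (κ × Fin s)).Nonempty :=
    Finset.card_pos.mp (hc ▸ one_le_meter m₂)
  have h4 := ((hasSpectrum_pureState o).tensor_flat (hasSpectrum_meterState s m₂)).sum_le_topSum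
    hc.le
  rw [sum_flat_of_subset (Finset.Subset.refl _), card_mul_inv_card hne] at h4
  have h5 := (h.tensor (hasSpectrum_meterState s m₁)).card_support_le (k := m₂.val) (by linarith)
  have h6 : (Finset.univ.filter fun x : κ × Fin s => p x.1 * flat (meterSupport s m₁) x.2 ≠ 0) =
      (Finset.univ.filter fun i => p i ≠ 0) ×ˢ meterSupport s m₁ := by
    ext x
    simp [flat, card_meterSupport, h1.ne', and_comm]
  rw [h6, Finset.card_product, card_meterSupport] at h5
  have h7 : ((Finset.univ.filter fun i => p i ≠ 0).card : ℝ) * m₁.val ≤ m₂.val := by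
    exact_mod_cast h5
  have h8 := Real.logb_le_logb_of_le (b := 2) (by norm_num) (by positivity) h7
  rw [Real.logb_mul h0.ne' h1.ne'] at h8
  rw [EReal.coe_le_coe_iff, meterParam, meterParam]
  linarith

theorem IsMeterLike.le_two_rpow {τ : DensityMatrix κ} {o : κ} {l : ℝ}
    (hτ : IsMeterLike (DensityMatrix.pureState o) τ l) {p : κ → ℝ}
    (h : HasSpectrum τ.toMatrix p) (i : κ) : p i ≤ 2 ^ (-l) := by
  rcases (h.nonneg i).eq_or_lt with h0 | h0
  · rw [← h0]; positivity
  · have := h.sMinus_le o h0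
    rw [hτ.1, EReal.coe_le_coe_iff] at this
    rw [← Real.logb_le_iff_le_rpow (by norm_num) h0]
    linarith

theorem IsMeterLike.card_support_le_two_rpow {τ : DensityMatrix κ} {o : κ} {l : ℝ}
    (hτ : IsMeterLike (DensityMatrix.pureState o) τ l) {p : κ → ℝ}
    (h : HasSpectrum τ.toMatrix p) : ((Finset.univ.filter fun i => p i ≠ 0).card : ℝ) ≤ 2 ^ l := by
  rcases (Nat.cast_nonneg (α := ℝ) (Finset.univ.filter fun i => p i ≠ 0).card).eq_or_lt with
    h0 | h0
  · rw [← h0]; positivity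
  · have := h.le_sPlus o
    rw [hτ.2, EReal.coe_le_coe_iff] at this
    rwa [← Real.logb_le_iff_le_rpow (by norm_num) h0]

/-- A flat state of rank `r` is a meter-like state with parameter `log₂ r`. -/
theorem isMeterLike_flatState (o : κ) (S : Finset κ) (hS : S.Nonempty) :
    IsMeterLike (DensityMatrix.pureState o) (flatState S hS) (Real.logb 2 S.card) := by
  have hτ := hasSpectrum_flatState S hS
  have hc : 1 ≤ S.card := hS.card_pos
  obtain ⟨j, hj⟩ := hS
  have hsupp : (Finset.univ.filter fun i => flat S i ≠ 0) = S := by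
    ext i
    simp [flat, show S.card ≠ 0 by omega]
  -- a meter of dimension `max 2 |S|` with the parameters `log₂ |S|` and `0` attains both entropies
  let mS : Finset.Icc 1 (max 2 S.card) := ⟨S.card, Finset.mem_Icc.mpr ⟨hc, le_max_right _ _⟩⟩
  let m1 : Finset.Icc 1 (max 2 S.card) := ⟨1, Finset.mem_Icc.mpr ⟨le_rfl, by omega⟩⟩
  have hs : 1 < max 2 S.card := by omega
  have hA : HasSpectrum ((DensityMatrix.pureState o).tensor (meterState _ mS)).toMatrix
      (flat ({o} ×ˢ meterSupport _ mS)) :=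
    (hasSpectrum_pureState o).tensor_flat (hasSpectrum_meterState _ mS)
  have hB : HasSpectrum ((flatState S ⟨j, hj⟩).tensor (meterState _ m1)).toMatrix
      (flat (S ×ˢ meterSupport _ m1)) :=
    hτ.tensor_flat (hasSpectrum_meterState _ m1)
  have hAc : ({o} ×ˢ meterSupport _ mS : Finset (κ × Fin (max 2 S.card))).card = S.card := by
    simp [card_meterSupport, mS]
  have hBc : (S ×ˢ meterSupport _ m1 : Finset (κ × Fin (max 2 S.card))).card = S.card := by
    simp [card_meterSupport, m1]
  have hpS : meterParam mS = Real.logb 2 S.card := rfl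
  have hp1 : meterParam m1 = 0 := by simp [meterParam, m1]
  constructor
  · apply le_antisymm
    · have := hτ.sMinus_le o (i := j) (by simpa [flat, hj] using hc)
      simpa [flat, hj] using this
    · refine le_sSup ⟨_, mS, m1, hs, DensityMatrix.Majorises.smoothMajorises_zero ?_, ?_⟩
      · refine hA.majorises_of_le (Finset.card_pos.mp (by omega)) hB fun x => ?_
        rw [hAc]
        exact (flat_le _ x).trans_eq (by rw [hBc])
      · rw [hpS, hp1, sub_zero]
  · apply le_antisymm
    · refine sInf_le ⟨_, m1, mS, hs, DensityMatrix.Majorises.smoothMajorises_zero ?_, ?_⟩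
      · refine hB.majorises_of_le (Finset.card_pos.mp (by omega)) hA fun x => ?_
        rw [hBc]
        exact (flat_le _ x).trans_eq (by rw [hAc])
      · rw [hpS, hp1, sub_zero]
    · have := hτ.le_sPlus o
      rwa [hsupp] at this

end Flat

/-! ### The asymptotic equipartition property -/

section AEP

open Filter

variable {ι : Type*} [Fintype ι]

/-- Chernoff's bound: a random variable with negative mean has an i.i.d. sum that is nonnegative
only with exponentially small probability. -/
theorem exists_sum_prod_le_pow {p h : ι → ℝ} (hp : ∀ j, 0 ≤ p j) (hp1 : ∑ j, p j = 1)
    (hneg : ∑ j, p j * h j < 0) :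
    ∃ c : ℝ, 0 ≤ c ∧ c < 1 ∧
      ∀ N : ℕ, ∑ x : Fin N → ι with 0 ≤ ∑ i, h (x i), ∏ i, p (x i) ≤ c ^ N := by
  set B : ℝ := 1 + ∑ j, |h j| with hB
  have hB1 : 1 ≤ B := le_add_of_nonneg_right (Finset.sum_nonneg fun j _ => abs_nonneg _)
  have hhB : ∀ j, |h j| ≤ B := fun j => by
    have := Finset.single_le_sum (f := fun j => |h j|) (fun j _ => abs_nonneg _)
      (Finset.mem_univ j)
    linarith
  set m : ℝ := -∑ j, p j * h j with hm
  have hm0 : 0 < m := by linarith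
  -- the tilting parameter is small enough for `exp x ≤ 1 + x + x ^ 2`, and for the linear term
  -- to dominate the quadratic one
  obtain ⟨t, ht0, htB, htm⟩ : ∃ t : ℝ, 0 < t ∧ t * B ≤ 1 ∧ t * B ^ 2 ≤ m / 2 := by
    refine ⟨min B⁻¹ (m / 2 / B ^ 2), by positivity, ?_, ?_⟩
    · calc _ ≤ B⁻¹ * B := mul_le_mul_of_nonneg_right (min_le_left _ _) (by positivity)
        _ = 1 := inv_mul_cancel₀ (by positivity)
    · calc _ ≤ m / 2 / B ^ 2 * B ^ 2 :=
            mul_le_mul_of_nonneg_right (min_le_right _ _) (by positivity)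
        _ = m / 2 := div_mul_cancel₀ _ (by positivity)
  refine ⟨∑ j, p j * Real.exp (t * h j),
    Finset.sum_nonneg fun j _ => mul_nonneg (hp j) (Real.exp_pos _).le, ?_, fun N => ?_⟩
  · have hexp : ∀ j, Real.exp (t * h j) ≤ 1 + t * h j + t ^ 2 * B ^ 2 := fun j => by
      have h1 : |t * h j| ≤ 1 := by
        rw [abs_mul, abs_of_pos ht0]
        exact (mul_le_mul_of_nonneg_left (hhB j) ht0.le).trans htB
      have h2 := (abs_le.mp (Real.abs_exp_sub_one_sub_id_le h1)).2
      have h3 : (t * h j) ^ 2 ≤ t ^ 2 * B ^ 2 := by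
        rw [mul_pow]
        exact mul_le_mul_of_nonneg_left (sq_le_sq' (by linarith [(abs_le.mp (hhB j)).1])
          (abs_le.mp (hhB j)).2) (sq_nonneg t)
      linarith
    calc ∑ j, p j * Real.exp (t * h j)
        ≤ ∑ j, p j * (1 + t * h j + t ^ 2 * B ^ 2) :=
          Finset.sum_le_sum fun j _ => mul_le_mul_of_nonneg_left (hexp j) (hp j)
      _ = ∑ j, (p j + t * (p j * h j) + t ^ 2 * B ^ 2 * p j) :=
          Finset.sum_congr rfl fun j _ => by ring
      _ = 1 - t * m + t * (t * B ^ 2) := by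
          rw [Finset.sum_add_distrib, Finset.sum_add_distrib, ← Finset.mul_sum, ← Finset.mul_sum,
            hp1, hm]
          ring
      _ < 1 := by nlinarith [mul_le_mul_of_nonneg_left htm ht0.le, mul_pos ht0 hm0]
  · rw [Fintype.sum_pow]
    have hnn : ∀ x : Fin N → ι, 0 ≤ ∏ i, p (x i) * Real.exp (t * h (x i)) := fun x =>
      Finset.prod_nonneg fun i _ => mul_nonneg (hp _) (Real.exp_pos _).le
    refine le_trans (Finset.sum_le_sum fun x hx => ?_)
      (Finset.sum_le_univ_sum_of_nonneg hnn)
    rw [Finset.prod_mul_distrib, ← Real.exp_sum, ← Finset.mul_sum]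
    refine le_mul_of_one_le_right (Finset.prod_nonneg fun i _ => hp _) (Real.one_le_exp ?_)
    exact mul_nonneg ht0.le (Finset.mem_filter.mp hx).2

theorem eventually_sum_prod_le {p h : ι → ℝ} (hp : ∀ j, 0 ≤ p j) (hp1 : ∑ j, p j = 1)
    (hneg : ∑ j, p j * h j < 0) {ε : ℝ} (hε : 0 < ε) :
    ∀ᶠ N : ℕ in atTop, ∑ x : Fin N → ι with 0 ≤ ∑ i, h (x i), ∏ i, p (x i) ≤ ε := by
  obtain ⟨c, hc0, hc1, hc⟩ := exists_sum_prod_le_pow hp hp1 hneg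
  filter_upwards [(tendsto_pow_atTop_nhds_zero_of_lt_one hc0 hc1).eventually_le_const hε]
    with N hN using (hc N).trans hN

theorem sum_logb_eq_logb_prod {ι : Type*} {p : ι → ℝ} {N : ℕ} {x : Fin N → ι} (hx : 0 < ∏ i, p (x i)) :
    ∑ i, Real.logb 2 (p (x i)) = Real.logb 2 (∏ i, p (x i)) :=
  (Real.logb_prod _ _ fun i _ h => hx.ne' (Finset.prod_eq_zero (Finset.mem_univ i) h)).symm

/-- Few sequences are much more likely than `2 ^ (-N H)`. -/
theorem eventually_sum_lt_prod_le {p : ι → ℝ} (hp : ∀ j, 0 ≤ p j) (hp1 : ∑ j, p j = 1) {H δ ε : ℝ}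
    (hH : H = -∑ j, p j * Real.logb 2 (p j)) (hδ : 0 < δ) (hε : 0 < ε) :
    ∀ᶠ N : ℕ in atTop,
      ∑ x : Fin N → ι with (2 : ℝ) ^ (-(N * (H - δ))) < ∏ i, p (x i), ∏ i, p (x i) ≤ ε := by
  have hneg : ∑ j, p j * (Real.logb 2 (p j) + (H - δ)) < 0 := by
    simp only [mul_add, Finset.sum_add_distrib, ← Finset.sum_mul, hp1]
    linarith
  filter_upwards [eventually_sum_prod_le hp hp1 hneg hε] with N hN
  refine le_trans (Finset.sum_le_sum_of_subset_of_nonneg (fun x hx => ?_)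
    fun x _ _ => Finset.prod_nonneg fun i _ => hp _) hN
  simp only [Finset.mem_filter, Finset.mem_univ, true_and] at hx ⊢
  have hpos : 0 < ∏ i, p (x i) := lt_trans (by positivity) hx
  have := Real.logb_lt_logb (b := 2) (by norm_num) (by positivity) hx
  rw [Real.logb_rpow (by norm_num) (by norm_num)] at this
  rw [Finset.sum_add_distrib, sum_logb_eq_logb_prod hpos]
  simp only [Finset.sum_const, Finset.card_univ, Fintype.card_fin, nsmul_eq_mul]
  linarith

/-- Sequences that are much less likely than `2 ^ (-N H)` carry little probability. -/
theorem eventually_sum_prod_lt_le {p : ι → ℝ} (hp : ∀ j, 0 ≤ p j) (hp1 : ∑ j, p j = 1) {H δ ε : ℝ}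
    (hH : H = -∑ j, p j * Real.logb 2 (p j)) (hδ : 0 < δ) (hε : 0 < ε) :
    ∀ᶠ N : ℕ in atTop,
      ∑ x : Fin N → ι with ∏ i, p (x i) < (2 : ℝ) ^ (-(N * (H + δ))), ∏ i, p (x i) ≤ ε := by
  have hneg : ∑ j, p j * (-Real.logb 2 (p j) + -(H + δ)) < 0 := by
    simp only [mul_add, mul_neg, Finset.sum_add_distrib, Finset.sum_neg_distrib,
      ← Finset.sum_mul, hp1]
    linarith
  filter_upwards [eventually_sum_prod_le hp hp1 hneg hε] with N hN
  refine le_trans ?_ hN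
  rw [Finset.sum_filter, Finset.sum_filter]
  refine Finset.sum_le_sum fun x _ => ?_
  have h0 : 0 ≤ ∏ i, p (x i) := Finset.prod_nonneg fun i _ => hp _
  split_ifs with h1 h2 h2
  · exact le_rfl
  · -- an unlikely sequence outside the large deviation event has probability zero
    refine (h0.eq_or_lt.resolve_right fun hpos => h2 ?_).ge
    have := Real.logb_lt_logb (b := 2) (by norm_num) hpos h1
    rw [Real.logb_rpow (by norm_num) (by norm_num)] at this
    rw [Finset.sum_add_distrib, Finset.sum_neg_distrib, sum_logb_eq_logb_prod hpos]
    simp only [Finset.sum_const, Finset.card_univ, Fintype.card_fin, nsmul_eq_mul]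
    linarith
  · exact h0
  · exact le_rfl

theorem sum_prod_eq_one {p : ι → ℝ} (hp1 : ∑ j, p j = 1) (N : ℕ) :
    ∑ x : Fin N → ι, ∏ i, p (x i) = 1 := by
  rw [← Fintype.sum_pow, hp1, one_pow]

end AEP

theorem card_filter_le_inv {κ : Type*} [Fintype κ] {p : κ → ℝ} (hp : ∀ i, 0 ≤ p i)
    (hp1 : ∑ i, p i = 1) {M : ℝ} (hM : 0 < M) :
    ((Finset.univ.filter fun i => M ≤ p i).card : ℝ) ≤ M⁻¹ := by
  rw [← mul_le_mul_iff_of_pos_right hM, inv_mul_cancel₀ hM.ne', ← nsmul_eq_mul]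
  exact (Finset.card_nsmul_le_sum _ _ _ fun i hi => (Finset.mem_filter.mp hi).2).trans
    (hp1 ▸ Finset.sum_le_univ_sum_of_nonneg hp)

theorem sum_filter_not_lt {κ : Type*} [Fintype κ] {p : κ → ℝ} (hp1 : ∑ i, p i = 1) (M : ℝ) :
    ∑ i with M ≤ p i, p i = 1 - ∑ i with p i < M, p i := by
  have := Finset.sum_filter_add_sum_filter_not Finset.univ (fun i => M ≤ p i) p
  simp only [not_le] at this
  linarith

/-! ### Smoothing by restriction to a set of high probability -/

section Smoothing

variable {κ : Type*} [Fintype κ] [DecidableEq κ]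

/-- Restricting the spectrum to a set `A` and renormalising moves the state by at most the
discarded probability. -/
theorem HasSpectrum.exists_restrict {ρ : DensityMatrix κ} {p : κ → ℝ}
    (h : HasSpectrum ρ.toMatrix p) {A : Finset κ} (hA : 0 < ∑ i ∈ A, p i) :
    ∃ σ : DensityMatrix κ,
      HasSpectrum σ.toMatrix (fun i => if i ∈ A then p i / ∑ j ∈ A, p j else 0) ∧
      ρ.traceDist σ ≤ 1 - ∑ i ∈ A, p i := by
  set Z := ∑ i ∈ A, p i with hZ
  have hZ1 : Z ≤ 1 := h.sum_eq_one ▸ Finset.sum_le_univ_sum_of_nonneg h.nonneg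
  obtain ⟨σ, hσ, hd⟩ := h.exists_traceDist_le (q := fun i => if i ∈ A then p i / Z else 0)
    (fun i => by
      have := h.nonneg i
      split_ifs <;> positivity)
    (by rw [Finset.sum_ite_mem, Finset.univ_inter, ← Finset.sum_div, ← hZ, div_self hA.ne'])
  refine ⟨σ, hσ, hd.trans (le_of_eq ?_)⟩
  have habs : ∀ i, |p i - if i ∈ A then p i / Z else 0| =
      p i + if i ∈ A then p i / Z - 2 * p i else 0 := fun i => by
    split_ifs with hi
    · have h1 : p i ≤ p i / Z := le_div_self (h.nonneg i) hA hZ1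
      rw [abs_of_nonpos (by linarith)]
      ring
    · rw [sub_zero, add_zero, abs_of_nonneg (h.nonneg i)]
  rw [Finset.sum_congr rfl fun i _ => habs i, Finset.sum_add_distrib, h.sum_eq_one,
    Finset.sum_ite_mem, Finset.univ_inter, Finset.sum_sub_distrib, ← Finset.sum_div,
    ← Finset.mul_sum, ← hZ, div_self hA.ne']
  ring

theorem DensityMatrix.SmoothMajorises.mono {ρ σ : DensityMatrix κ} {ε ε' : ℝ}
    (h : DensityMatrix.SmoothMajorises ε ρ σ) (hε : ε ≤ ε') :
    DensityMatrix.SmoothMajorises ε' ρ σ := by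
  obtain ⟨ρ', σ', a, b, h1, h2, h3, h4⟩ := h
  exact ⟨ρ', σ', a, b, h1, h2, h3, h4.trans hε⟩

/-- A state that is concentrated on a set of eigenvectors precedes the flat state on that set. -/
theorem HasSpectrum.smoothMajorises_flatState {ρ : DensityMatrix κ} {p : κ → ℝ}
    (h : HasSpectrum ρ.toMatrix p) {S : Finset κ} (hS : S.Nonempty) {ε : ℝ} (hε : ε < 1)
    (hpS : 1 - ε ≤ ∑ i ∈ S, p i) : DensityMatrix.SmoothMajorises ε ρ (flatState S hS) := by
  obtain ⟨σ, hσ, hd⟩ := h.exists_restrict (A := S) (by linarith)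
  refine ⟨σ, flatState S hS, ε, 0, ?_, ?_, traceDist_self_le _, by linarith⟩
  · exact hσ.majorises_of_support_subset (fun i hi => if_neg hi) hS (hasSpectrum_flatState S hS)
  · exact hd.trans (by linarith)

/-- If the eigenvalues above `M` carry little weight, then a flat state of rank at most `(2 M)⁻¹`
precedes the state. The factor `2` absorbs the renormalisation. -/
theorem HasSpectrum.flatState_smoothMajorises {ρ : DensityMatrix κ} {p : κ → ℝ}
    (h : HasSpectrum ρ.toMatrix p) {S : Finset κ} (hS : S.Nonempty) {ε M : ℝ} (hε : ε ≤ 1 / 2)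
    (hM : 0 < M) (hpM : ∑ i with M < p i, p i ≤ ε)
    (hSM : S.card = 1 ∨ (S.card : ℝ) ≤ (2 * M)⁻¹) :
    DensityMatrix.SmoothMajorises ε (flatState S hS) ρ := by
  have hZ := Finset.sum_filter_add_sum_filter_not Finset.univ (fun i => M < p i) p
  rw [h.sum_eq_one] at hZ
  obtain ⟨σ, hσ, hd⟩ := h.exists_restrict (A := Finset.univ.filter fun i => ¬ M < p i)
    (by linarith)
  refine ⟨flatState S hS, σ, 0, ε, ?_, traceDist_self_le _, ?_, by linarith⟩
  · refine (hasSpectrum_flatState S hS).majorises_of_le hS hσ fun i => ?_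
    rcases hSM with hS1 | hS2
    · rw [hS1, Nat.cast_one, inv_one, ← hσ.sum_eq_one]
      exact Finset.single_le_sum (fun i _ => hσ.nonneg i) (Finset.mem_univ i)
    · have hc : (0 : ℝ) < S.card := by exact_mod_cast hS.card_pos
      have h1 : 2 * M ≤ (S.card : ℝ)⁻¹ := by
        rw [← inv_inv (2 * M)]
        exact inv_anti₀ hc hS2
      refine le_trans ?_ h1
      split_ifs with hi
      · rw [div_le_iff₀ (by linarith)]
        have h2 : p i ≤ M := not_lt.mp (Finset.mem_filter.mp hi).2
        nlinarith
      · positivity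
  · exact hd.trans (by linarith)

end Smoothing

/-! ### The i.i.d. state is a thermodynamic equilibrium state -/

section Macro

open Filter

theorem eventually_ceil_mul_add_le {a b : ℝ} (hab : a < b) (C : ℝ) :
    ∃ n₀ : ℝ≥0, ∀ n, n₀ ≤ n → (⌈n⌉₊ : ℝ) * a + C ≤ n * b := by
  refine ⟨Real.toNNReal ((|a| + C) / (b - a)), fun n hn => ?_⟩
  have h1 : (|a| + C) / (b - a) ≤ n := Real.toNNReal_le_iff_le_coe.mp hn
  rw [div_le_iff₀ (sub_pos.mpr hab)] at h1
  have h2 : (n : ℝ) ≤ ⌈n⌉₊ := by exact_mod_cast Nat.le_ceil n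
  have h3 : (⌈n⌉₊ : ℝ) ≤ n + 1 := by exact_mod_cast (Nat.ceil_lt_add_one zero_le).le
  have h4 : ((⌈n⌉₊ : ℝ) - n) * a ≤ |a| :=
    (mul_le_mul_of_nonneg_left (le_abs_self a) (by linarith)).trans
      (mul_le_of_le_one_left (abs_nonneg a) (by linarith))
  linarith

theorem eventually_le_mul_ceil {a b : ℝ} (hab : a < b) (C : ℝ) :
    ∃ n₀ : ℝ≥0, ∀ n, n₀ ≤ n → (n : ℝ) * a ≤ (⌈n⌉₊ : ℝ) * b - C := by
  obtain ⟨n₀, h⟩ := eventually_ceil_mul_add_le (neg_lt_neg hab) C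
  exact ⟨n₀, fun n hn => by linarith [h n hn]⟩

theorem exists_forall_ceil {P : ℕ → Prop} (h : ∀ᶠ N in atTop, P N) :
    ∃ n₀ : ℝ≥0, ∀ n, n₀ ≤ n → P ⌈n⌉₊ := by
  obtain ⟨N₀, hN⟩ := eventually_atTop.mp h
  exact ⟨N₀, fun n hn => hN _ (by exact_mod_cast hn.trans (Nat.le_ceil n))⟩

theorem eventually_two_rpow_le {c ε : ℝ} (hc : 0 < c) (hε : 0 < ε) :
    ∀ᶠ N : ℕ in atTop, (2 : ℝ) ^ (-(N * c)) ≤ ε := by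
  have h : (2 : ℝ) ^ (-c) < 1 := Real.rpow_lt_one_of_one_lt_of_neg (by norm_num) (by linarith)
  filter_upwards [(tendsto_pow_atTop_nhds_zero_of_lt_one (by positivity) h).eventually_le_const hε]
    with N hN
  rw [← Real.rpow_natCast, ← Real.rpow_mul (by norm_num)] at hN
  rwa [neg_mul, mul_comm] at hN

variable {ι : Type*} [Fintype ι]

/-- The sequences of length `N` whose i.i.d. probability is at least `2 ^ (-N a)`. -/
noncomputable def likelySet (p : ι → ℝ) (a : ℝ) (N : ℕ) : Finset (Fin N → ι) :=
  Finset.univ.filter fun x => (2 : ℝ) ^ (-(N * a)) ≤ ∏ i, p (x i)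

theorem card_likelySet_le {p : ι → ℝ} (hp : ∀ j, 0 ≤ p j) (hp1 : ∑ j, p j = 1) (a : ℝ) (N : ℕ) :
    ((likelySet p a N).card : ℝ) ≤ 2 ^ (N * a) := by
  have := card_filter_le_inv (p := fun x : Fin N → ι => ∏ i, p (x i))
    (fun x => Finset.prod_nonneg fun i _ => hp _) (sum_prod_eq_one hp1 N)
    (M := (2 : ℝ) ^ (-(N * a))) (by positivity)
  rwa [← Real.rpow_neg (by norm_num), neg_neg] at this

theorem eventually_le_sum_likelySet {p : ι → ℝ} (hp : ∀ j, 0 ≤ p j) (hp1 : ∑ j, p j = 1)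
    {H δ ε : ℝ} (hH : H = -∑ j, p j * Real.logb 2 (p j)) (hδ : 0 < δ) (hε : 0 < ε) :
    ∀ᶠ N : ℕ in atTop, 1 - ε ≤ ∑ x ∈ likelySet p (H + δ) N, ∏ i, p (x i) := by
  filter_upwards [eventually_sum_prod_lt_le hp hp1 hH hδ hε] with N hN
  rw [likelySet, sum_filter_not_lt (sum_prod_eq_one hp1 N)]
  linarith

variable [DecidableEq ι]

theorem HasSpectrum.tensorPower {ρ : DensityMatrix ι} {p : ι → ℝ}
    (h : HasSpectrum ρ.toMatrix p) (N : ℕ) :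
    HasSpectrum (ρ.tensorPower N).toMatrix (fun x => ∏ i, p (x i)) :=
  h.matrixTensorPower N

/-- Flat states on the sets of likely sequences bound the i.i.d. state from above. -/
theorem exists_macroPrec_flat (o : ι) (ρ : DensityMatrix ι) {p : ι → ℝ}
    (h : HasSpectrum ρ.toMatrix p) {H δ : ℝ} (hH : H = -∑ j, p j * Real.logb 2 (p j))
    (hδ : 0 < δ) :
    ∃ (τ : ∀ n, DensityMatrix (copies ι n)) (l : ℝ≥0 → ℝ),
      (∀ n, IsMeterLike (iidRef o n) (τ n) (l n)) ∧ MacroPrec (iid ρ) τ ∧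
      ∃ n₀ : ℝ≥0, ∀ n, n₀ ≤ n → l n ≤ n * (H + δ) := by
  have hp := h.nonneg
  have hp1 := h.sum_eq_one
  have hT : ∀ n : ℝ≥0, ∃ S : Finset (copies ι n), S.Nonempty ∧
      ((likelySet p (H + δ / 2) ⌈n⌉₊).Nonempty → S = likelySet p (H + δ / 2) ⌈n⌉₊) := fun n => by
    by_cases hne : (likelySet p (H + δ / 2) ⌈n⌉₊).Nonempty
    · exact ⟨_, hne, fun _ => rfl⟩
    · exact ⟨{fun _ => o}, Finset.singleton_nonempty _, fun h => absurd h hne⟩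
  choose S hS hST using hT
  have hlarge : ∀ ε : ℝ, 0 < ε → ε < 1 → ∃ n₀ : ℝ≥0, ∀ n, n₀ ≤ n →
      S n = likelySet p (H + δ / 2) ⌈n⌉₊ ∧ 1 - ε ≤ ∑ x ∈ S n, ∏ i, p (x i) := fun ε hε hε1 => by
    obtain ⟨n₀, hn₀⟩ := exists_forall_ceil
      (eventually_le_sum_likelySet hp hp1 hH (half_pos hδ) hε)
    refine ⟨n₀, fun n hn => ?_⟩
    have hne : (likelySet p (H + δ / 2) ⌈n⌉₊).Nonempty := by
      by_contra hne
      have := hn₀ n hn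
      rw [Finset.not_nonempty_iff_eq_empty.mp hne, Finset.sum_empty] at this
      linarith
    rw [hST n hne]
    exact ⟨rfl, hn₀ n hn⟩
  refine ⟨fun n => flatState (S n) (hS n), fun n => Real.logb 2 (S n).card,
    fun n => isMeterLike_flatState _ _ _, fun ε hε => ?_, ?_⟩
  · obtain ⟨n₀, hn₀⟩ := hlarge (min ε (1 / 2)) (by positivity)
      (lt_of_le_of_lt (min_le_right _ _) (by norm_num))
    exact ⟨n₀, fun n hn => ((h.tensorPower ⌈n⌉₊).smoothMajorises_flatState (hS n)
      (lt_of_le_of_lt (min_le_right _ _) (by norm_num)) (hn₀ n hn).2).mono (min_le_left _ _)⟩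
  · obtain ⟨n₀, hn₀⟩ := hlarge (1 / 2) (by norm_num) (by norm_num)
    obtain ⟨n₁, hn₁⟩ := eventually_ceil_mul_add_le (show H + δ / 2 < H + δ by linarith) 0
    refine ⟨max n₀ n₁, fun n hn => ?_⟩
    have h1 := hn₁ n ((le_max_right _ _).trans hn)
    have h2 : ((S n).card : ℝ) ≤ 2 ^ (⌈n⌉₊ * (H + δ / 2)) := by
      rw [(hn₀ n ((le_max_left _ _).trans hn)).1]
      exact card_likelySet_le hp hp1 _ _
    have h3 := (Real.logb_le_iff_le_rpow (by norm_num)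
      (by exact_mod_cast (hS n).card_pos)).mpr h2
    linarith

/-- Flat states of rank about `2 ^ (N (H - δ))` bound the i.i.d. state from below. -/
theorem exists_flat_macroPrec (o : ι) (ρ : DensityMatrix ι) {p : ι → ℝ}
    (h : HasSpectrum ρ.toMatrix p) {H δ : ℝ} (hH : H = -∑ j, p j * Real.logb 2 (p j))
    (hδ : 0 < δ) :
    ∃ (τ : ∀ n, DensityMatrix (copies ι n)) (l : ℝ≥0 → ℝ),
      (∀ n, IsMeterLike (iidRef o n) (τ n) (l n)) ∧ MacroPrec τ (iid ρ) ∧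
      ∃ n₀ : ℝ≥0, ∀ n, n₀ ≤ n → n * (H - δ) ≤ l n := by
  have hp := h.nonneg
  have hp1 := h.sum_eq_one
  let M : ℕ → ℝ := fun N => (2 : ℝ) ^ (-(N * (H - δ / 2)))
  have hM : ∀ N, 0 < M N := fun N => by positivity
  let r : ℕ → ℕ := fun N => max 1 ⌊(2 * M N)⁻¹⌋₊
  have hT : ∀ n : ℝ≥0, ∃ S : Finset (copies ι n), S.Nonempty ∧
      (r ⌈n⌉₊ ≤ Fintype.card (copies ι n) → S.card = r ⌈n⌉₊) := fun n => by
    by_cases hr : r ⌈n⌉₊ ≤ Fintype.card (copies ι n)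
    · obtain ⟨S, -, hS⟩ := Finset.exists_subset_card_eq
        (s := (Finset.univ : Finset (copies ι n))) (n := r ⌈n⌉₊) hr
      exact ⟨S, Finset.card_pos.mp (hS ▸ lt_of_lt_of_le one_pos (le_max_left _ _)), fun _ => hS⟩
    · exact ⟨{fun _ => o}, Finset.singleton_nonempty _, fun h => absurd h hr⟩
  choose S hS hST using hT
  have hlarge : ∀ ε : ℝ, 0 < ε → ε ≤ 1 / 2 → ∃ n₀ : ℝ≥0, ∀ n, n₀ ≤ n →
      (S n).card = r ⌈n⌉₊ ∧
        ∑ x : copies ι n with M ⌈n⌉₊ < ∏ i, p (x i), ∏ i, p (x i) ≤ ε := fun ε hε hε1 => by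
    obtain ⟨n₀, hn₀⟩ := exists_forall_ceil
      (eventually_sum_lt_prod_le hp hp1 hH (half_pos hδ) hε)
    refine ⟨n₀, fun n hn => ⟨hST n ?_, hn₀ n hn⟩⟩
    -- at least half of the probability sits on eigenvalues at most `M`
    have h1 := Finset.sum_filter_add_sum_filter_not Finset.univ
      (fun x : copies ι n => M ⌈n⌉₊ < ∏ i, p (x i)) fun x => ∏ i, p (x i)
    rw [sum_prod_eq_one hp1] at h1
    have h2 : ∑ x : copies ι n with ¬ M ⌈n⌉₊ < ∏ i, p (x i), ∏ i, p (x i) ≤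
        Fintype.card (copies ι n) * M ⌈n⌉₊ := by
      refine (Finset.sum_le_card_nsmul _ _ _ fun x hx =>
        not_lt.mp (Finset.mem_filter.mp hx).2).trans ?_
      rw [nsmul_eq_mul]
      exact mul_le_mul_of_nonneg_right (by exact_mod_cast Finset.card_le_univ _) (hM _).le
    refine max_le (Fintype.card_pos_iff.mpr ⟨fun _ => o⟩) (Nat.floor_le_of_le ?_)
    rw [inv_le_iff_one_le_mul₀ (by linarith [hM ⌈n⌉₊])]
    have h3 : ∑ x : copies ι n with M ⌈n⌉₊ < ∏ i, p (x i), ∏ i, p (x i) ≤ ε := hn₀ n hn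
    linarith
  refine ⟨fun n => flatState (S n) (hS n), fun n => Real.logb 2 (S n).card,
    fun n => isMeterLike_flatState _ _ _, fun ε hε => ?_, ?_⟩
  · obtain ⟨n₀, hn₀⟩ := hlarge (min ε (1 / 2)) (by positivity) (min_le_right _ _)
    refine ⟨n₀, fun n hn => ((h.tensorPower ⌈n⌉₊).flatState_smoothMajorises (hS n)
      (min_le_right _ _) (hM _) (hn₀ n hn).2 ?_).mono (min_le_left _ _)⟩
    rw [(hn₀ n hn).1]
    rcases le_total ⌊(2 * M ⌈n⌉₊)⁻¹⌋₊ 1 with h1 | h1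
    · exact Or.inl (max_eq_left h1)
    · right
      rw [show r ⌈n⌉₊ = ⌊(2 * M ⌈n⌉₊)⁻¹⌋₊ from max_eq_right h1]
      exact Nat.floor_le (by have := hM ⌈n⌉₊; positivity)
  · obtain ⟨n₀, hn₀⟩ := hlarge (1 / 2) (by norm_num) le_rfl
    obtain ⟨n₁, hn₁⟩ := eventually_le_mul_ceil (show H - δ < H - δ / 2 by linarith) 2
    refine ⟨max n₀ n₁, fun n hn => ?_⟩
    have h1 := hn₁ n ((le_max_right _ _).trans hn)
    -- rounding loses at most a factor `2`
    have h2 : (2 * M ⌈n⌉₊)⁻¹ / 2 ≤ (S n).card := by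
      rw [(hn₀ n ((le_max_left _ _).trans hn)).1]
      have h3 := Nat.lt_floor_add_one (2 * M ⌈n⌉₊)⁻¹
      have h4 : (1 : ℝ) ≤ r ⌈n⌉₊ := by exact_mod_cast le_max_left _ _
      have h5 : (⌊(2 * M ⌈n⌉₊)⁻¹⌋₊ : ℝ) ≤ r ⌈n⌉₊ := by exact_mod_cast le_max_right _ _
      linarith
    refine h1.trans ((Real.le_logb_iff_rpow_le (by norm_num)
      (by exact_mod_cast (hS n).card_pos)).mpr (le_trans (le_of_eq ?_) h2))
    rw [Real.rpow_sub (by norm_num), mul_inv, ← Real.rpow_neg (by norm_num), neg_neg]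
    norm_num
    ring

theorem isEquilibriumWith_iid (o : ι) (ρ : DensityMatrix ι) :
    IsEquilibriumWith (iidRef o) (iid ρ) ρ.vonNeumannEntropy := by
  intro δ hδ
  have h := hasSpectrum_eigenvalues ρ.isHermitian
  obtain ⟨τm, lm, h1, h2, h3⟩ := exists_flat_macroPrec o ρ h (vonNeumannEntropy_eq ρ) hδ
  obtain ⟨τp, lp, h4, h5, h6⟩ := exists_macroPrec_flat o ρ h (vonNeumannEntropy_eq ρ) hδ
  exact ⟨τm, τp, lm, lp, h1, h4, h2, h5, h3, h6⟩

/-! ### Uniqueness of the parameter -/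

/-- Every eventual property holds at some macroscopic scale that is an integer. -/
theorem exists_natCast_scale {P : ℝ≥0 → Prop} (h : ∃ n₀ : ℝ≥0, ∀ n, n₀ ≤ n → P n) :
    ∃ n : ℝ≥0, (⌈n⌉₊ : ℝ) = n ∧ P n := by
  obtain ⟨n₀, h⟩ := h
  exact ⟨(⌈n₀⌉₊ : ℝ≥0), by simp, h _ (Nat.le_ceil n₀)⟩

/-- A meter-like state that precedes the i.i.d. state cannot have an entropy rate above `H`: its
eigenvalues would be too small to carry the mass of the likely sequences. -/
theorem le_of_macroPrec_iid (o : ι) (ρ : DensityMatrix ι) {p : ι → ℝ}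
    (h : HasSpectrum ρ.toMatrix p) {H l : ℝ} (hH : H = -∑ j, p j * Real.logb 2 (p j))
    {τ : ∀ n, DensityMatrix (copies ι n)} {lm : ℝ≥0 → ℝ}
    (hτ : ∀ n, IsMeterLike (iidRef o n) (τ n) (lm n)) (hprec : MacroPrec τ (iid ρ))
    (hlm : ∃ n₀ : ℝ≥0, ∀ n, n₀ ≤ n → n * l ≤ lm n) : l ≤ H := by
  by_contra! hlt
  have hp := h.nonneg
  have hp1 := h.sum_eq_one
  obtain ⟨δ, hδ⟩ : ∃ δ : ℝ, l = H + 2 * δ := ⟨(l - H) / 2, by ring⟩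
  have hδ0 : 0 < δ := by linarith
  obtain ⟨n₀, hn₀⟩ := hprec (1 / 8) (by norm_num)
  obtain ⟨n₁, hn₁⟩ := hlm
  obtain ⟨n₂, hn₂⟩ := exists_forall_ceil ((eventually_le_sum_likelySet hp hp1 hH hδ0
    (show (0 : ℝ) < 1 / 4 by norm_num)).and (eventually_two_rpow_le hδ0
    (show (0 : ℝ) < 1 / 4 by norm_num)))
  obtain ⟨n, hceil, hn⟩ := exists_natCast_scale (P := fun n => n₀ ≤ n ∧ n₁ ≤ n ∧ n₂ ≤ n)
    ⟨max n₀ (max n₁ n₂), fun n hn => by simpa using hn⟩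
  obtain ⟨hlik, hpow⟩ := hn₂ n hn.2.2
  have hlarge := hn₁ n hn.2.1
  set T := likelySet p (H + δ) ⌈n⌉₊ with hT
  have hTne : T.Nonempty := by
    by_contra hne
    rw [Finset.not_nonempty_iff_eq_empty.mp hne, Finset.sum_empty] at hlik
    linarith
  have h1 := topSum_le_of_smoothMajorises (hn₀ n hn.1) hTne.card_pos (Finset.card_le_univ T)
  have h2 : ∑ x ∈ T, ∏ i, p (x i) ≤ (iid ρ n).topSum T.card :=
    (h.tensorPower ⌈n⌉₊).sum_le_topSum le_rfl
  have hspec := hasSpectrum_eigenvalues (τ n).isHermitian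
  have h3 := hspec.topSum_le_mul (by positivity) ((hτ n).le_two_rpow hspec) T.card
  have h4 : (T.card : ℝ) * 2 ^ (-lm n) ≤ 1 / 4 := by
    calc (T.card : ℝ) * 2 ^ (-lm n)
        ≤ 2 ^ (⌈n⌉₊ * (H + δ)) * 2 ^ (-((⌈n⌉₊ : ℝ) * l)) := by
          refine mul_le_mul (card_likelySet_le hp hp1 _ _) ?_ (by positivity) (by positivity)
          exact Real.rpow_le_rpow_of_exponent_le (by norm_num) (by rw [hceil]; linarith)
      _ = 2 ^ (-((⌈n⌉₊ : ℝ) * δ)) := by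
          rw [← Real.rpow_add (by norm_num), hδ]
          congr 1
          ring
      _ ≤ 1 / 4 := hpow
  linarith

/-- A meter-like state that the i.i.d. state precedes cannot have an entropy rate below `H`: the
likely sequences do not fit into a space of its rank. -/
theorem le_of_iid_macroPrec (o : ι) (ρ : DensityMatrix ι) {p : ι → ℝ}
    (h : HasSpectrum ρ.toMatrix p) {H l : ℝ} (hH : H = -∑ j, p j * Real.logb 2 (p j))
    {τ : ∀ n, DensityMatrix (copies ι n)} {lp : ℝ≥0 → ℝ}
    (hτ : ∀ n, IsMeterLike (iidRef o n) (τ n) (lp n)) (hprec : MacroPrec (iid ρ) τ)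
    (hlp : ∃ n₀ : ℝ≥0, ∀ n, n₀ ≤ n → lp n ≤ n * l) : H ≤ l := by
  by_contra! hlt
  have hp := h.nonneg
  have hp1 := h.sum_eq_one
  obtain ⟨δ, hδ⟩ : ∃ δ : ℝ, l = H - 2 * δ := ⟨(H - l) / 2, by ring⟩
  have hδ0 : 0 < δ := by linarith
  obtain ⟨n₀, hn₀⟩ := hprec (1 / 8) (by norm_num)
  obtain ⟨n₁, hn₁⟩ := hlp
  obtain ⟨n₂, hn₂⟩ := exists_forall_ceil ((eventually_sum_lt_prod_le hp hp1 hH hδ0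
    (show (0 : ℝ) < 1 / 4 by norm_num)).and (eventually_two_rpow_le hδ0
    (show (0 : ℝ) < 1 / 4 by norm_num)))
  obtain ⟨n, hceil, hn⟩ := exists_natCast_scale (P := fun n => n₀ ≤ n ∧ n₁ ≤ n ∧ n₂ ≤ n)
    ⟨max n₀ (max n₁ n₂), fun n hn => by simpa using hn⟩
  obtain ⟨hhigh, hpow⟩ := hn₂ n hn.2.2
  have hsmall := hn₁ n hn.2.1
  have hspec := hasSpectrum_eigenvalues (τ n).isHermitian
  have hrank := (hτ n).card_support_le_two_rpow hspec
  set R := Finset.univ.filter fun x => (τ n).isHermitian.eigenvalues x ≠ 0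
  have hsum : ∑ x ∈ R, (τ n).isHermitian.eigenvalues x = 1 := by
    rw [Finset.sum_filter_ne_zero, hspec.sum_eq_one]
  have hRne : R.Nonempty := by
    by_contra hne
    rw [Finset.not_nonempty_iff_eq_empty.mp hne, Finset.sum_empty] at hsum
    exact zero_ne_one hsum
  have h1 := topSum_le_of_smoothMajorises (hn₀ n hn.1) hRne.card_pos (Finset.card_le_univ R)
  have h2 := hspec.sum_le_topSum (le_refl R.card)
  obtain ⟨w, hw, hwX⟩ := (h.tensorPower ⌈n⌉₊).exists_isWeight_topSum_eq R.card
  have h3 := hw.sum_mul_le_add (h.tensorPower ⌈n⌉₊).nonneg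
    (M := (2 : ℝ) ^ (-((⌈n⌉₊ : ℝ) * (H - δ)))) (by positivity)
  have h4 : (R.card : ℝ) * 2 ^ (-((⌈n⌉₊ : ℝ) * (H - δ))) ≤ 1 / 4 := by
    calc (R.card : ℝ) * 2 ^ (-((⌈n⌉₊ : ℝ) * (H - δ)))
        ≤ 2 ^ ((⌈n⌉₊ : ℝ) * l) * 2 ^ (-((⌈n⌉₊ : ℝ) * (H - δ))) := by
          refine mul_le_mul_of_nonneg_right (hrank.trans ?_) (by positivity)
          exact Real.rpow_le_rpow_of_exponent_le (by norm_num) (by rw [hceil]; exact hsmall)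
      _ = 2 ^ (-((⌈n⌉₊ : ℝ) * δ)) := by
          rw [← Real.rpow_add (by norm_num), hδ]
          congr 1
          ring
      _ ≤ 1 / 4 := hpow
  have h5 : (iid ρ n).topSum R.card = (ρ.tensorPower ⌈n⌉₊).topSum R.card := rfl
  linarith

theorem IsEquilibriumWith.eq_vonNeumannEntropy {o : ι} {ρ : DensityMatrix ι} {l : ℝ}
    (hl : IsEquilibriumWith (iidRef o) (iid ρ) l) : l = ρ.vonNeumannEntropy := by
  have h := hasSpectrum_eigenvalues ρ.isHermitian
  refine le_antisymm (le_of_forall_pos_sub_le fun δ hδ => ?_)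
    (le_of_forall_pos_le_add fun δ hδ => ?_)
  · obtain ⟨τm, τp, lm, lp, h1, h2, h3, h4, h5, h6⟩ := hl δ hδ
    exact le_of_macroPrec_iid o ρ h (vonNeumannEntropy_eq ρ) h1 h3 h5
  · obtain ⟨τm, τp, lm, lp, h1, h2, h3, h4, h5, h6⟩ := hl δ hδ
    exact le_of_iid_macroPrec o ρ h (vonNeumannEntropy_eq ρ) h2 h4 h6

end Macro

end SmoothThermo

theorem mainTheorem2 {ι : Type*} [Fintype ι] [DecidableEq ι] (o : ι)
    (ρ : SmoothThermo.DensityMatrix ι) :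
    SmoothThermo.IsThermodynamicEquilibrium (SmoothThermo.iidRef o) (SmoothThermo.iid ρ) ∧
      ∀ l : ℝ, SmoothThermo.IsEquilibriumWith (SmoothThermo.iidRef o) (SmoothThermo.iid ρ) l ↔
        l = ρ.vonNeumannEntropy :=
  ⟨⟨_, SmoothThermo.isEquilibriumWith_iid o ρ⟩, fun _ =>
    ⟨fun h => h.eq_vonNeumannEntropy, fun h => h ▸ SmoothThermo.isEquilibriumWith_iid o ρ⟩⟩
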